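/- Let $G$ be a locally compact, Hausdorff topological groupoid (not assumed second countable) with object space $G^0$, arrow space $G^1$, range and source maps $r,s\colon G^1\to G^0$, and with a (left invariant) Haar system $\alpha=(\alpha^x)_{x\in G^0}$, that is, a left invariant, continuous family of Radon measures on $G^1$ with $\operatorname{supp}\alpha^x=r^{-1}(x)$. Let $\tilde\alpha_x$ be the push-forward of $\alpha^x$ along inversion. Equip $\mathrm C_c(G^1)$ with the $^*$-algebra structure $$(f_1*f_2)(g)=\int f_1(h)f_2(h^{-1}g)\,\mathrm d\alpha^{r(g)}(h),\qquad f^*(g)=\overline{f(g^{-1})},$$ with the $I$-norm $$\|f\|_I=\max\Bigl\{\sup_{x\in G^0}\int|f|\,\mathrm d\alpha^x,\ \sup_{x\in G^0}\int|f|\,\mathrm d\tilde\alpha_x\Bigr\},$$ and with the inductive limit topology, that is, the finest locally convex vector space topology for which the inclusions of the subspaces of functions supported in $K$ with the supremum norm are continuous, for all compact $K\subseteq G^1$. Let $D$ be a $\mathrm C^*$-algebra and let $\mathcal F$ be a (right) Hilbert $D$-module, with $\mathrm C^*$-algebra $\mathbb B(\mathcal F)$ of adjointable operators. A representation of $\mathrm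 C_c(G^1)$ on $\mathcal F$ is a $^*$-homomorphism $L\colon\mathrm C_c(G^1)\to\mathbb B(\mathcal F)$ that is nondegenerate, that is, the linear span of the vectors $L(f)\xi$ is dense in $\mathcal F$. It is called $I$-norm bounded if there is a constant $C$ with $\|L(f)\|\le C\|f\|_I$ for all $f$. A pre-representation of $\mathrm C_c(G^1)$ on $\mathcal F$ is a triple $(L,\mathcal F_0,\iota)$, where $\mathcal F_0$ is a complex vector space, $\iota\colon\mathcal F_0\to\mathcal F$ is a linear map with dense image (not necessarily injective), and $L$ is a linear map from $\mathrm C_c(G^1)$ to the space of linear maps $\mathcal F_0\to\mathcal F$, such that 1. for all $\xi,\eta\in\mathcal F_0$, the map $f\mapsto\langle\iota(\xi),L(f)\eta\rangle$ from $\mathrm C_c(G^1)$ with the inductive limit topology to $D$ with the norm topology is continuous; 2. $\langle L(f_1)\xi,L(f_2)\eta\rangle=\langle\iota(\xi),L(f_1^**f_2)\eta\rangle$ for all $f_1,f_2\in\mathrm C_c(G^1)$, $\xi,\eta\in\mathcal F_0$; 3. the linear span of the vectors $L(f)\xi$ with $f\in\mathrm C_c(G^1)$, $\xi\in\mathcal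 F_0$ is dense in $\mathcal F$. Then for every pre-representation $(L,\mathcal F_0,\iota)$ of $\mathrm C_c(G^1)$ on $\mathcal F$ there is an $I$-norm bounded representation $L'\colon\mathrm C_c(G^1)\to\mathbb B(\mathcal F)$ with $L'(f)(\iota(\xi))=L(f)(\xi)$ for all $f\in\mathrm C_c(G^1)$, $\xi\in\mathcal F_0$. In particular, a representation $L$ of $\mathrm C_c(G^1)$ on $\mathcal F$ is $I$-norm bounded if and only if it is continuous in the inductive limit topology. Here continuity may be understood either for the norm topology on $\mathbb B(\mathcal F)$ or as continuity of $f\mapsto\langle\xi,L(f)\eta\rangle\in D$ for all $\xi,\eta\in\mathcal F$: each of these two conditions is equivalent to $I$-norm boundedness. -/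

import Mathlib

open MeasureTheory Topology Filter MulOpposite
open scoped CompactlySupported

/-- A topological groupoid with object space `G₀` and arrow space `G₁`.  The product `mul g h` is
meaningful only for composable pairs, that is, if `s g = r h`; its values at other pairs are
arbitrary and play no role. -/
structure TopologicalGroupoid (G₀ G₁ : Type*) [TopologicalSpace G₀] [TopologicalSpace G₁] where
  /-- the range map -/
  r : G₁ → G₀
  /-- the source map -/
  s : G₁ → G₀
  /-- the unit arrow of an object -/
  unit : G₀ → G₁
  /-- the inverse of an arrow -/
  inv : G₁ → G₁
  /-- the product of composable arrows -/
  mul : G₁ → G₁ → G₁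
  r_unit : ∀ x, r (unit x) = x
  s_unit : ∀ x, s (unit x) = x
  r_inv : ∀ g, r (inv g) = s g
  s_inv : ∀ g, s (inv g) = r g
  r_mul : ∀ g h, s g = r h → r (mul g h) = r g
  s_mul : ∀ g h, s g = r h → s (mul g h) = s h
  mul_assoc : ∀ g h k, s g = r h → s h = r k → mul (mul g h) k = mul g (mul h k)
  unit_mul : ∀ g, mul (unit (r g)) g = g
  mul_unit : ∀ g, mul g (unit (s g)) = g
  inv_mul : ∀ g, mul (inv g) g = unit (s g)
  mul_inv : ∀ g, mul g (inv g) = unit (r g)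
  continuous_r : Continuous r
  continuous_s : Continuous s
  continuous_unit : Continuous unit
  continuous_inv : Continuous inv
  continuousOn_mul : ContinuousOn (fun p : G₁ × G₁ => mul p.1 p.2) {p | s p.1 = r p.2}

namespace TopologicalGroupoid

variable {G₀ G₁ : Type*} [TopologicalSpace G₀] [TopologicalSpace G₁] (G : TopologicalGroupoid G₀ G₁)

lemma continuousOn_div :
    ContinuousOn (fun p : G₁ × G₁ => G.mul (G.inv p.2) p.1) {p | G.r p.2 = G.r p.1} := by
  have h : Continuous fun p : G₁ × G₁ => (G.inv p.2, p.1) := by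
    have := G.continuous_inv
    fun_prop
  exact G.continuousOn_mul.comp h.continuousOn fun p hp => by
    simpa [G.s_inv] using hp

lemma mul_div {g h : G₁} (e : G.r h = G.r g) :
    G.mul h (G.mul (G.inv h) g) = g := by
  rw [← G.mul_assoc h (G.inv h) g (G.r_inv h).symm ((G.s_inv h).trans e), G.mul_inv, e, G.unit_mul]

lemma inv_inv (g : G₁) : G.inv (G.inv g) = g := by
  have h : G.mul (G.inv g) (G.inv (G.inv g)) = G.mul (G.inv g) g := by
    rw [G.mul_inv, G.inv_mul, G.r_inv]
  calc G.inv (G.inv g) = G.mul g (G.mul (G.inv g) (G.inv (G.inv g))) := by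
        rw [← G.mul_assoc g (G.inv g) _ (G.r_inv g).symm (G.r_inv _).symm, G.mul_inv,
          ← G.s_inv g, ← G.r_inv (G.inv g), G.unit_mul]
    _ = g := by rw [h, G.inv_mul, G.mul_unit]

lemma exists_extension_fibre [T2Space G₀] [T2Space G₁] [LocallyCompactSpace G₁]
    (f₁ f₂ : C_c(G₁, ℂ)) (g : G₁) :
    ∃ φ : C(G₁, ℂ), ∀ h ∈ tsupport f₁, G.r h = G.r g → φ h = f₂ (G.mul (G.inv h) g) := by
  have hcl : IsClosed {h | G.r h = G.r g} := isClosed_eq G.continuous_r continuous_const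
  have hC : IsCompact (tsupport f₁ ∩ {h | G.r h = G.r g}) :=
    f₁.hasCompactSupport.isCompact.inter_right hcl
  have : CompactSpace ↑(tsupport f₁ ∩ {h | G.r h = G.r g}) := isCompact_iff_compactSpace.1 hC
  let e : ↑(tsupport f₁ ∩ {h | G.r h = G.r g}) → OnePoint G₁ := fun h => ((h : G₁) : OnePoint G₁)
  have he : IsClosedEmbedding e :=
    (OnePoint.continuous_coe.comp continuous_subtype_val).isClosedEmbedding
      (OnePoint.coe_injective.comp Subtype.val_injective)
  have hc : Continuous fun h : ↑(tsupport f₁ ∩ {h | G.r h = G.r g}) =>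
      f₂ (G.mul (G.inv h) g) := by
    refine f₂.continuous.comp ((continuousOn_iff_continuous_domRestrict (f := fun h => G.mul (G.inv h) g)).1 ?_)
    exact G.continuousOn_div.comp (f := fun h => (g, h)) (by fun_prop) fun h hh => hh.2
  obtain ⟨ψ, hψ⟩ := ContinuousMap.exists_extension' he ⟨_, hc⟩
  refine ⟨ψ.comp ⟨_, OnePoint.continuous_coe⟩, fun h h1 h2 => ?_⟩
  exact congrFun hψ ⟨h, h1, h2⟩

/-- The involution on `C_c(G¹)`: `f^*(g) = conj (f(g⁻¹))`. -/
noncomputable def invol [T2Space G₁] (f : C_c(G₁, ℂ)) : C_c(G₁, ℂ) where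
  toFun g := star (f (G.inv g))
  continuous_toFun := continuous_star.comp (f.continuous.comp G.continuous_inv)
  hasCompactSupport' := by
    refine HasCompactSupport.intro
      (f.hasCompactSupport.isCompact.image G.continuous_inv) fun g hg => ?_
    by_contra hne
    refine hg ⟨G.inv g, subset_tsupport _ fun h0 => hne (by simp [h0]), G.inv_inv g⟩

end TopologicalGroupoid

/-- A (left invariant) Haar system on a topological groupoid: a continuous family of Radon measures
`α x`, `x ∈ G₀`, with support equal to the range fibre `{g | r g = x}`, that is left invariant. -/
structure HaarSystem {G₀ G₁ : Type*} [TopologicalSpace G₀] [TopologicalSpace G₁]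
    [MeasurableSpace G₁] [BorelSpace G₁] (G : TopologicalGroupoid G₀ G₁) where
  /-- the measure on the range fibre over an object -/
  measure : G₀ → Measure G₁
  regular : ∀ x, (measure x).Regular
  support_eq : ∀ x, (measure x).support = {g | G.r g = x}
  continuous_integral : ∀ f : C_c(G₁, ℂ), Continuous fun x => ∫ g, f g ∂(measure x)
  left_invariant : ∀ (f : C_c(G₁, ℂ)) (g : G₁),
    ∫ h, f (G.mul g h) ∂(measure (G.s g)) = ∫ h, f h ∂(measure (G.r g))

namespace HaarSystem

variable {G₀ G₁ : Type*} [TopologicalSpace G₀] [TopologicalSpace G₁]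
  [MeasurableSpace G₁] [BorelSpace G₁] {G : TopologicalGroupoid G₀ G₁} (α : HaarSystem G)

/-- The right invariant Haar system: the push-forward of the left invariant one along inversion,
living on the source fibres. -/
noncomputable def rightMeasure (x : G₀) : Measure G₁ := (α.measure x).map G.inv

/-- The value at `g` of the convolution product `f₁ * f₂`. -/
noncomputable def convFun (f₁ f₂ : C_c(G₁, ℂ)) (g : G₁) : ℂ :=
  ∫ h, f₁ h * f₂ (G.mul (G.inv h) g) ∂(α.measure (G.r g))

lemma ae_mem_fibre (x : G₀) : ∀ᵐ g ∂(α.measure x), G.r g = x := by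
  have := α.regular x
  have h : (α.measure x).support ∈ ae (α.measure x) :=
    Measure.support_mem_ae_of_innerRegularWRT_isCompact_isOpen Measure.Regular.innerRegular
  rw [α.support_eq] at h
  exact h

lemma integrable_cc (f : C_c(G₁, ℂ)) (x : G₀) : Integrable (fun g => f g) (α.measure x) := by
  have := α.regular x
  exact f.continuous.integrable_of_hasCompactSupport f.hasCompactSupport

variable [T2Space G₀]

lemma integrable_conv (f₁ f₂ : C_c(G₁, ℂ)) (g : G₁) :
    Integrable (fun h => f₁ h * f₂ (G.mul (G.inv h) g)) (α.measure (G.r g)) := by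
  have hcl : IsClosed {h | G.r h = G.r g} := isClosed_eq G.continuous_r continuous_const
  obtain ⟨M, hM⟩ := f₂.continuous.bounded_above_of_compact_support f₂.hasCompactSupport
  refine Integrable.mono' ((α.integrable_cc f₁ (G.r g)).norm.mul_const M) ?_ ?_
  · rw [← Measure.restrict_eq_self_of_ae_mem (α.ae_mem_fibre (G.r g))]
    refine ContinuousOn.aestronglyMeasurable ?_ hcl.measurableSet
    refine f₁.continuous.continuousOn.mul (f₂.continuous.comp_continuousOn ?_)
    exact G.continuousOn_div.comp (f := fun h => (g, h)) (by fun_prop) fun h hh => hh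
  · refine ae_of_all _ fun h => ?_
    rw [norm_mul]
    exact mul_le_mul_of_nonneg_left (hM _) (norm_nonneg _)

lemma hasCompactSupport_convFun [T2Space G₁] (f₁ f₂ : C_c(G₁, ℂ)) :
    HasCompactSupport (α.convFun f₁ f₂) := by
  have hK : IsCompact ((tsupport f₁ ×ˢ tsupport f₂) ∩ {p : G₁ × G₁ | G.s p.1 = G.r p.2}) :=
    (f₁.hasCompactSupport.isCompact.prod f₂.hasCompactSupport.isCompact).inter_right
      (isClosed_eq (G.continuous_s.comp continuous_fst) (G.continuous_r.comp continuous_snd))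
  have hK' := hK.image_of_continuousOn (G.continuousOn_mul.mono Set.inter_subset_right)
  refine HasCompactSupport.intro hK' fun g hg => ?_
  refine integral_eq_zero_of_ae ?_
  filter_upwards [α.ae_mem_fibre (G.r g)] with h hh
  by_contra hne
  have h1 : f₁ h ≠ 0 := fun h0 => hne (by simp [h0])
  have h2 : f₂ (G.mul (G.inv h) g) ≠ 0 := fun h0 => hne (by simp [h0])
  refine hg ⟨(h, G.mul (G.inv h) g), ⟨⟨subset_tsupport _ h1, subset_tsupport _ h2⟩, ?_⟩,
    G.mul_div hh⟩
  change G.s h = G.r _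
  rw [G.r_mul _ _ ((G.s_inv h).trans hh), G.r_inv]

lemma continuous_convFun [T2Space G₁] [LocallyCompactSpace G₁] (f₁ f₂ : C_c(G₁, ℂ)) :
    Continuous (α.convFun f₁ f₂) := by
  refine continuous_iff_continuousAt.2 fun g₀ => ?_
  obtain ⟨φ, hφ⟩ := G.exists_extension_fibre f₁ f₂ g₀
  let F : C_c(G₁, ℂ) := ⟨⟨fun h => f₁ h * φ h, by fun_prop⟩,
    HasCompactSupport.mul_right f₁.hasCompactSupport⟩
  let A : C_c(G₁, ℂ) := ⟨⟨fun h => (‖f₁ h‖ : ℂ), by fun_prop⟩,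
    f₁.hasCompactSupport.comp_left (g := fun z : ℂ => ((‖z‖ : ℝ) : ℂ)) (by simp)⟩
  have hN : Continuous fun g => ∫ h, ‖f₁ h‖ ∂(α.measure (G.r g)) := by
    have := Complex.continuous_re.comp ((α.continuous_integral A).comp G.continuous_r)
    refine this.congr fun g => ?_
    change (∫ h, ((‖f₁ h‖ : ℝ) : ℂ) ∂(α.measure (G.r g))).re = _
    rw [integral_complex_ofReal, Complex.ofReal_re]
  have hJ : Continuous fun g => ∫ h, F h ∂(α.measure (G.r g)) :=
    (α.continuous_integral F).comp G.continuous_r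
  -- uniform closeness near `g₀`
  have key : ∀ ε > 0, ∀ᶠ g in 𝓝 g₀, ∀ h ∈ tsupport f₁,
      G.r h = G.r g → ‖f₂ (G.mul (G.inv h) g) - φ h‖ < ε := by
    intro ε hε
    refine f₁.hasCompactSupport.isCompact.eventually_forall_of_forall_eventually fun h₀ hh₀ => ?_
    by_cases e : G.r h₀ = G.r g₀
    · have hc : ContinuousOn (fun p : G₁ × G₁ => ‖f₂ (G.mul (G.inv p.2) p.1) - φ p.2‖)
          {p | G.r p.2 = G.r p.1} :=
        ((f₂.continuous.comp_continuousOn G.continuousOn_div).sub (by fun_prop)).norm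
      have h0 := (hc (g₀, h₀) e).eventually_lt (g := fun _ => ε) continuousWithinAt_const
        (by simpa [hφ h₀ hh₀ e] using hε)
      exact eventually_nhdsWithin_iff.1 h0
    · have ho : IsOpen {p : G₁ × G₁ | G.r p.2 = G.r p.1}ᶜ :=
        (isClosed_eq (G.continuous_r.comp continuous_snd)
          (G.continuous_r.comp continuous_fst)).isOpen_compl
      filter_upwards [ho.mem_nhds (x := (g₀, h₀)) e] with p hp hp' using absurd hp' hp
  have bound : ∀ ε, 0 ≤ ε → ∀ g, (∀ h ∈ tsupport f₁,
      G.r h = G.r g → ‖f₂ (G.mul (G.inv h) g) - φ h‖ ≤ ε) →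
      ‖α.convFun f₁ f₂ g - ∫ h, F h ∂(α.measure (G.r g))‖ ≤
        ε * ∫ h, ‖f₁ h‖ ∂(α.measure (G.r g)) := by
    intro ε hε g hg
    rw [convFun, ← integral_sub (α.integrable_conv f₁ f₂ g) (α.integrable_cc F _),
      ← integral_const_mul]
    refine norm_integral_le_of_norm_le ((α.integrable_cc f₁ _).norm.const_mul ε) ?_
    filter_upwards [α.ae_mem_fibre (G.r g)] with h hh
    change ‖f₁ h * _ - f₁ h * φ h‖ ≤ _
    rw [← mul_sub, norm_mul, mul_comm]
    by_cases hm : h ∈ tsupport f₁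
    · exact mul_le_mul_of_nonneg_right (hg h hm hh) (norm_nonneg _)
    · simp [image_eq_zero_of_notMem_tsupport hm]
  have h0 : α.convFun f₁ f₂ g₀ = ∫ h, F h ∂(α.measure (G.r g₀)) := by
    have := bound 0 le_rfl g₀ fun h h1 h2 => by simp [hφ h h1 h2]
    rw [zero_mul, norm_le_zero_iff, sub_eq_zero] at this
    exact this
  rw [Metric.continuousAt_iff']
  intro ε hε
  set N₀ := ∫ h, ‖f₁ h‖ ∂(α.measure (G.r g₀)) with hN₀
  have hN₀' : 0 ≤ N₀ := integral_nonneg fun _ => norm_nonneg _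
  have hδ : 0 < ε / (2 * (N₀ + 1)) := by positivity
  have e1 := key _ hδ
  have e2 : ∀ᶠ g in 𝓝 g₀, ∫ h, ‖f₁ h‖ ∂(α.measure (G.r g)) < N₀ + 1 :=
    hN.continuousAt.eventually_lt continuousAt_const (by simp [← hN₀])
  have e3 := Metric.continuousAt_iff'.1 (hJ.continuousAt (x := g₀)) (ε / 2) (by positivity)
  filter_upwards [e1, e2, e3] with g h1 h2 h3
  have h4 := bound _ hδ.le g fun h a b => (h1 h a b).le
  have h5 : ε / (2 * (N₀ + 1)) * ∫ h, ‖f₁ h‖ ∂(α.measure (G.r g)) ≤ ε / 2 := by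
    calc _ ≤ ε / (2 * (N₀ + 1)) * (N₀ + 1) := mul_le_mul_of_nonneg_left h2.le hδ.le
      _ = ε / 2 := by field_simp
  rw [← h0] at h3
  calc dist (α.convFun f₁ f₂ g) (α.convFun f₁ f₂ g₀)
      ≤ dist (α.convFun f₁ f₂ g) (∫ h, F h ∂(α.measure (G.r g)))
        + dist (∫ h, F h ∂(α.measure (G.r g))) (α.convFun f₁ f₂ g₀) := dist_triangle _ _ _
    _ < ε / 2 + ε / 2 := by
        rw [dist_eq_norm (α.convFun f₁ f₂ g)]
        exact add_lt_add_of_le_of_lt (h4.trans h5) h3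
    _ = ε := by ring

/-- The convolution product on `C_c(G¹)`:
`(f₁ * f₂)(g) = ∫ f₁(h) f₂(h⁻¹ g) dα^{r(g)}(h)`. -/
noncomputable def conv [T2Space G₁] [LocallyCompactSpace G₁] (f₁ f₂ : C_c(G₁, ℂ)) : C_c(G₁, ℂ) where
  toFun := α.convFun f₁ f₂
  continuous_toFun := α.continuous_convFun f₁ f₂
  hasCompactSupport' := α.hasCompactSupport_convFun f₁ f₂

/-- The `I`-norm: the maximum of the suprema over `x ∈ G⁰` of the integrals of `|f|` over the range
fibre and over the source fibre of `x`. -/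
noncomputable def iNorm (f : C_c(G₁, ℂ)) : ℝ :=
  max (⨆ x, ∫ g, ‖f g‖ ∂(α.measure x)) (⨆ x, ∫ g, ‖f g‖ ∂(α.rightMeasure x))

end HaarSystem

/-- The sup-norm topology on the space of functions in `C_c(X)` with support in `K`. -/
@[reducible]
noncomputable def supNormTopology {X : Type*} [TopologicalSpace X] (K : Set X) :
    TopologicalSpace {f : C_c(X, ℂ) // tsupport f ⊆ K} :=
  TopologicalSpace.induced (fun f => f.1.toBoundedContinuousFunction) inferInstance

/-- The inductive limit topology on `C_c(X)`: the finest locally convex vector space topology for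
which the inclusions of the normed spaces of functions supported in `K` are continuous, for all
compact subsets `K` of `X`. -/
@[reducible]
noncomputable def inductiveLimitTopology (X : Type*) [TopologicalSpace X] :
    TopologicalSpace C_c(X, ℂ) :=
  sInf {t | @IsTopologicalAddGroup _ t _ ∧ @ContinuousSMul ℂ _ _ _ t ∧
    @LocallyConvexSpace ℝ _ _ _ _ _ t ∧
    ∀ K : Set X, IsCompact K →
      @Continuous {f : C_c(X, ℂ) // tsupport f ⊆ K} _ (supNormTopology K) t Subtype.val}

section Representations

variable {G₀ G₁ : Type*} [TopologicalSpace G₀] [T2Space G₀] [TopologicalSpace G₁] [T2Space G₁]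
  [LocallyCompactSpace G₁] [MeasurableSpace G₁] [BorelSpace G₁] {G : TopologicalGroupoid G₀ G₁}

/-- The `D`-valued inner product of a right Hilbert `D`-module `F`.  A right `D`-module structure is
an action of `Dᵐᵒᵖ`.  Mathlib's Hilbert modules are, in effect, left modules (an element `a` that
acts on the second entry of the inner product comes out on the left), so a right Hilbert `D`-module
is a `CStarModule Dᵐᵒᵖ F`. -/
def rightInner (D : Type*) {F : Type*} [Inner Dᵐᵒᵖ F] (ξ η : F) : D :=
  unop (inner Dᵐᵒᵖ ξ η)

/-- The usual axiom `⟨ξ, η · a⟩ = ⟨ξ, η⟩ a` of right Hilbert modules. -/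
lemma rightInner_smul {D F : Type*} [NonUnitalCStarAlgebra D] [PartialOrder D]
    [NormedAddCommGroup F] [NormedSpace ℂ F] [SMul Dᵐᵒᵖ F] [CStarModule Dᵐᵒᵖ F]
    (ξ η : F) (a : D) : rightInner D ξ (op a • η) = rightInner D ξ η * a := by
  simp [rightInner]

/-- A pre-representation of `C_c(G¹)` on the Hilbert `D`-module `F` with (not necessarily injective)
domain `ι : F₀ → F`. -/
structure PreRepresentation (α : HaarSystem G) (D F F₀ : Type*) [NonUnitalCStarAlgebra D]
    [PartialOrder D] [NormedAddCommGroup F] [NormedSpace ℂ F] [SMul Dᵐᵒᵖ F] [CStarModule Dᵐᵒᵖ F]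
    [AddCommGroup F₀] [Module ℂ F₀] where
  /-- the linear map from the domain to the Hilbert module -/
  ι : F₀ →ₗ[ℂ] F
  denseRange_ι : DenseRange ι
  /-- the action of functions by linear maps from the domain to the Hilbert module -/
  L : C_c(G₁, ℂ) →ₗ[ℂ] F₀ →ₗ[ℂ] F
  continuous_inner : ∀ ξ η : F₀,
    Continuous[inductiveLimitTopology G₁, inferInstance] fun f => rightInner D (ι ξ) (L f η)
  inner_eq : ∀ (f₁ f₂ : C_c(G₁, ℂ)) (ξ η : F₀),
    rightInner D (L f₁ ξ) (L f₂ η) = rightInner D (ι ξ) (L (α.conv (G.invol f₁) f₂) η)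
  nondegenerate : Dense (Submodule.span ℂ {v : F | ∃ f ξ, L f ξ = v} : Set F)

/-- A representation of the `*`-algebra `C_c(G¹)` on the Hilbert `D`-module `F`: a nondegenerate
`*`-homomorphism to the `C*`-algebra of adjointable operators on `F`, with the operator norm.
The operator `L f` is adjointable with adjoint `L (f^*)` by `inner_star`. -/
structure CcRepresentation (α : HaarSystem G) (D F : Type*) [NonUnitalCStarAlgebra D]
    [PartialOrder D] [NormedAddCommGroup F] [NormedSpace ℂ F] [SMul Dᵐᵒᵖ F]
    [CStarModule Dᵐᵒᵖ F] where
  /-- the action of functions by bounded operators -/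
  L : C_c(G₁, ℂ) →ₗ[ℂ] F →L[ℂ] F
  map_conv : ∀ f₁ f₂ : C_c(G₁, ℂ), L (α.conv f₁ f₂) = (L f₁).comp (L f₂)
  inner_star : ∀ (f : C_c(G₁, ℂ)) (ξ η : F),
    rightInner D (L f ξ) η = rightInner D ξ (L (G.invol f) η)
  nondegenerate : Dense (Submodule.span ℂ {v : F | ∃ f ξ, L f ξ = v} : Set F)

/-- Boundedness with respect to the `I`-norm. -/
def CcRepresentation.IsINormBounded {α : HaarSystem G} {D F : Type*} [NonUnitalCStarAlgebra D]
    [PartialOrder D] [NormedAddCommGroup F] [NormedSpace ℂ F] [SMul Dᵐᵒᵖ F] [CStarModule Dᵐᵒᵖ F]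
    (R : CcRepresentation α D F) : Prop :=
  ∃ C : ℝ, ∀ f : C_c(G₁, ℂ), ‖R.L f‖ ≤ C * α.iNorm f

end Representations

/-!
Let `(L, F₀, ι)` be a pre-representation and let `v = ∑ L(k_i) ξ_i`.  The heart of the matter is
the operator inequality `⟨L(f) v, L(f) v⟩ ≤ c² ⟨v, v⟩` in `D` for `c ≥ ‖f‖_I`, where `L(f) v` stands
for `∑ L(f * k_i) ξ_i`.  No disintegration, second countability or approximate unit is used.

The idea is the Cauchy–Schwarz estimate for `⟨w, L(f) v⟩ = ⟨a ⊗ w, U (b ⊗ v)⟩`, where `f = a b`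
pointwise with `|a|² = |b|² = |f|`, the inner product is that of the tensor product of
`L²(G¹, r, α)` with `F` over `C₀(G⁰)`, and `U` is the translation `(U Φ)(g, h) = Φ(g, g⁻¹ h)`.
Instead of this tensor product, functions of two arrows are used directly.  They have a
`C_c(G¹)`-valued inner product `HaarSystem.pairing`, the integral over `g` of `Φ(g, ⬝)^* * Ψ(g, ⬝)`.
For `Φ = a ⊗ (f * k) - c U (b ⊗ k)`, left invariance and Fubini's theorem show that the pairing
consists of weighted convolution products, with weights `∫ |f| dα^x` and `∫ |f(g⁻¹)| dα^x(g)` that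
are at most `‖f‖_I` (`HaarSystem.pairing_translate`, `HaarSystem.exists_pairing_eq`).

The functional `∑ ⟨ι ξ_i, L(⬝) ξ_j⟩` is nonnegative on matrices `(f_i^* * f_j)`.  It is
nonnegative on pairings because a partition of unity in the variable `g` exhibits these as limits,
uniform with supports in a fixed compact set, of sums of such matrices
(`HaarSystem.exists_riemann_sum`, `matrixSum_pairing_nonneg`); this is where continuity in the
inductive limit topology enters.  A weight `ρ ≤ c` may be replaced by `c` because `c - ρ` has a
continuous square root (`matrixSum_rangeMul_le`).  Together this gives
`0 ≤ c ⟨L(f) v, L(f) v⟩ - 2 c ⟨L(f) v, L(f) v⟩ + c³ ⟨v, v⟩` (`matrixSum_conv_le`).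

So `L(k) ξ ↦ L(f * k) ξ` extends to a bounded operator on `F` of norm at most `‖f‖_I`
(`PreRepresentation.operator`), and the algebraic properties of the resulting representation follow
by testing on vectors `L(k) ξ`.  The continuity criteria follow: a weakly continuous representation
is a pre-representation with `F₀ = F`, and the `I`-norm is dominated by the supremum norm on
functions with support in a fixed compact set.
-/

/-! ### Compactly supported functions -/

section Topology

variable {X Y : Type*} [TopologicalSpace X] [TopologicalSpace Y]

/-- Tietze extension with compact support.  It turns functions that make sense only for composable
arrows into elements of `C_c(X)`. -/
lemma exists_compactlySupported_extension [T2Space X] [LocallyCompactSpace X] {C K : Set X}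
    (hC : IsClosed C) (hK : IsCompact K) {f : X → ℂ} (hf : ContinuousOn f C)
    (h0 : ∀ x ∈ C, x ∉ K → f x = 0) : ∃ φ : C_c(X, ℂ), ∀ x ∈ C, φ x = f x := by
  obtain ⟨K', hK', hKK'⟩ := exists_compact_superset hK
  have hCK : IsCompact (C ∩ K') := hK'.inter_left hC
  have : CompactSpace ↑(C ∩ K') := isCompact_iff_compactSpace.1 hCK
  let e : ↑(C ∩ K') → OnePoint X := fun h => ((h : X) : OnePoint X)
  have he : IsClosedEmbedding e :=
    (OnePoint.continuous_coe.comp continuous_subtype_val).isClosedEmbedding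
      (OnePoint.coe_injective.comp Subtype.val_injective)
  have hc : Continuous fun h : ↑(C ∩ K') => f h :=
    (continuousOn_iff_continuous_domRestrict.1 (hf.mono Set.inter_subset_left))
  -- `X` need not be normal, but its one-point compactification is
  obtain ⟨ψ, hψ⟩ := ContinuousMap.exists_extension' he ⟨_, hc⟩
  obtain ⟨χ, hχ1, hχ0, hχc, -⟩ := exists_continuous_one_zero_of_isCompact hK
    isOpen_interior.isClosed_compl (Set.disjoint_compl_right_iff_subset.mpr hKK')
  refine ⟨⟨⟨fun x => (χ x : ℂ) * ψ (x : OnePoint X), ?_⟩, ?_⟩, fun x hx => ?_⟩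
  · have := ψ.continuous.comp (OnePoint.continuous_coe (X := X))
    exact (Complex.continuous_ofReal.comp χ.continuous).mul this
  · exact (hχc.comp_left (g := fun t : ℝ => (t : ℂ)) (by simp)).mul_right
  · change (χ x : ℂ) * ψ (x : OnePoint X) = f x
    by_cases hxK : x ∈ K
    · have h1 : χ x = 1 := hχ1 hxK
      have h2 : ψ (x : OnePoint X) = f x := congrFun hψ ⟨x, hx, interior_subset (hKK' hxK)⟩
      rw [h1, h2]; simp
    · rw [h0 x hx hxK]
      by_cases hxK' : x ∈ K'
      · have h2 : ψ (x : OnePoint X) = f x := congrFun hψ ⟨x, hx, hxK'⟩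
        rw [h2, h0 x hx hxK, mul_zero]
      · have h1 : χ x = 0 := hχ0 fun h => hxK' (interior_subset h)
        rw [h1]; simp

/-- A compactly supported function of two variables depends on the first one uniformly in the
second one. -/
lemma CompactlySupportedContinuousMap.eventually_forall_norm_sub_lt (Ψ : C_c(X × Y, ℂ)) (x₀ : X)
    {ε : ℝ} (hε : 0 < ε) : ∀ᶠ x in 𝓝 x₀, ∀ y, ‖Ψ (x, y) - Ψ (x₀, y)‖ < ε := by
  have hK : IsCompact (Prod.snd '' tsupport Ψ) :=
    Ψ.hasCompactSupport.isCompact.image continuous_snd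
  have h0 : ∀ x, ∀ y ∉ Prod.snd '' tsupport Ψ, Ψ (x, y) = 0 := fun x y hy =>
    image_eq_zero_of_notMem_tsupport fun h => hy ⟨_, h, rfl⟩
  have : ∀ᶠ x in 𝓝 x₀, ∀ y ∈ Prod.snd '' tsupport Ψ, ‖Ψ (x, y) - Ψ (x₀, y)‖ < ε := by
    refine hK.eventually_forall_of_forall_eventually fun y₀ _ => ?_
    have hc : Continuous fun p : X × Y => ‖Ψ p - Ψ (x₀, p.2)‖ := by
      have := Ψ.continuous
      fun_prop
    exact hc.continuousAt.eventually_lt continuousAt_const (by simpa using hε)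
  filter_upwards [this] with x hx y
  by_cases hy : y ∈ Prod.snd '' tsupport Ψ
  · exact hx y hy
  · simpa [h0 _ y hy] using hε

/-- A partition of unity on a compact set that is subordinate to a neighbourhood assignment `U` and
supported in a given compact neighbourhood. -/
lemma exists_finite_partition [T2Space X] [LocallyCompactSpace X] {K K' : Set X}
    (hK : IsCompact K) (hKK' : K ⊆ interior K') {U : X → Set X} (hU : ∀ x, IsOpen (U x))
    (hxU : ∀ x, x ∈ U x) :
    ∃ (t : Finset X) (p : t → X → ℝ), (∀ m, Continuous (p m)) ∧ (∀ m, HasCompactSupport (p m)) ∧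
      (∀ m x, 0 ≤ p m x) ∧ (∀ m x, p m x ≠ 0 → x ∈ U m ∧ x ∈ K') ∧
      (∀ x ∈ K, ∑ m, p m x = 1) ∧ ∀ x, ∑ m, p m x ≤ 1 := by
  obtain ⟨t, -, ht⟩ := hK.elim_nhds_subcover (fun g => U g ∩ interior K')
    (fun g hg => ((hU g).inter isOpen_interior).mem_nhds ⟨hxU g, hKK' hg⟩)
  obtain ⟨p, hp, hpc⟩ := PartitionOfUnity.exists_isSubordinate_of_locallyFinite_t2space hK
    (fun m : t => U m ∩ interior K') (fun m => (hU m).inter isOpen_interior)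
    (locallyFinite_of_finite _) (fun x hx => by
      obtain ⟨m, hm, hxm⟩ := Set.mem_iUnion₂.1 (ht hx)
      exact Set.mem_iUnion.2 ⟨⟨m, hm⟩, hxm⟩)
  refine ⟨t, fun m => p m, fun m => (p m).continuous, hpc, p.nonneg, fun m x hx => ?_,
    fun x hx => ?_, fun x => ?_⟩
  · have := hp m (subset_tsupport _ hx)
    exact ⟨this.1, interior_subset this.2⟩
  · rw [← finsum_eq_sum_of_fintype]; exact p.sum_eq_one hx
  · rw [← finsum_eq_sum_of_fintype]; exact p.sum_le_one x

end Topology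

/-! ### Groupoid algebra -/

namespace TopologicalGroupoid

variable {G₀ G₁ : Type*} [TopologicalSpace G₀] [TopologicalSpace G₁] (G : TopologicalGroupoid G₀ G₁)

lemma r_inv_mul {g h : G₁} (e : G.r h = G.r g) : G.r (G.mul (G.inv h) g) = G.s h := by
  rw [G.r_mul _ _ ((G.s_inv h).trans e), G.r_inv]

lemma inv_mul_cancel_left {g h : G₁} (e : G.s h = G.r g) : G.mul (G.inv h) (G.mul h g) = g := by
  rw [← G.mul_assoc _ _ _ (G.s_inv h) e, G.inv_mul, e, G.unit_mul]

lemma inv_unique {g h : G₁} (e : G.s g = G.r h) (e' : G.mul g h = G.unit (G.r g)) :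
    h = G.inv g := by
  rw [← G.inv_mul_cancel_left e, e', ← G.s_inv g, G.mul_unit]

lemma inv_mul_rev {g h : G₁} (e : G.s g = G.r h) :
    G.inv (G.mul g h) = G.mul (G.inv h) (G.inv g) := by
  have e1 : G.s (G.inv h) = G.r (G.inv g) := by rw [G.s_inv, G.r_inv, e]
  refine (G.inv_unique ?_ ?_).symm
  · rw [G.s_mul _ _ e, G.r_mul _ _ e1, G.r_inv]
  · rw [G.mul_assoc _ _ _ e (by rw [G.r_mul _ _ e1, G.r_inv]),
      ← G.mul_assoc h _ _ (G.r_inv h).symm e1, G.mul_inv, ← e, ← G.r_inv g, G.unit_mul, G.mul_inv,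
      G.r_mul _ _ e]

lemma continuousOn_inv_mul {X : Type*} [TopologicalSpace X] {u v : X → G₁} {S : Set X}
    (hu : ContinuousOn u S) (hv : ContinuousOn v S) (h : ∀ x ∈ S, G.r (u x) = G.r (v x)) :
    ContinuousOn (fun x => G.mul (G.inv (u x)) (v x)) S :=
  G.continuousOn_div.comp (hv.prodMk hu) h

lemma isClosed_fibre [T2Space G₀] (x : G₀) : IsClosed {g | G.r g = x} :=
  isClosed_eq G.continuous_r continuous_const

lemma invol_apply [T2Space G₁] (f : C_c(G₁, ℂ)) (g : G₁) : G.invol f g = star (f (G.inv g)) := rfl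

lemma invol_invol [T2Space G₁] (f : C_c(G₁, ℂ)) : G.invol (G.invol f) = f := by
  ext g
  simp [invol_apply, G.inv_inv]

/-- The set of products of composable arrows from two sets. -/
def mulSet (K L : Set G₁) : Set G₁ :=
  (fun p : G₁ × G₁ => G.mul p.1 p.2) '' ((K ×ˢ L) ∩ {p | G.s p.1 = G.r p.2})

lemma isCompact_mulSet [T2Space G₀] {K L : Set G₁} (hK : IsCompact K) (hL : IsCompact L) :
    IsCompact (G.mulSet K L) :=
  ((hK.prod hL).inter_right (isClosed_eq (G.continuous_s.comp continuous_fst)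
    (G.continuous_r.comp continuous_snd))).image_of_continuousOn
      (G.continuousOn_mul.mono Set.inter_subset_right)

lemma mem_mulSet {K L : Set G₁} {g h : G₁} (hg : g ∈ K) (e : G.r g = G.r h)
    (h' : G.mul (G.inv g) h ∈ L) : h ∈ G.mulSet K L :=
  ⟨(g, G.mul (G.inv g) h), ⟨⟨hg, h'⟩, (G.r_inv_mul e).symm⟩, G.mul_div e⟩

end TopologicalGroupoid

/-! ### Integration over the fibres and the convolution algebra -/

namespace HaarSystem

variable {G₀ G₁ : Type*} [TopologicalSpace G₀] [TopologicalSpace G₁]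
  [MeasurableSpace G₁] [BorelSpace G₁] {G : TopologicalGroupoid G₀ G₁} (α : HaarSystem G)

lemma integral_congr_fibre {E : Type*} [NormedAddCommGroup E] [NormedSpace ℝ E] {x : G₀}
    {f₁ f₂ : G₁ → E} (h : ∀ g, G.r g = x → f₁ g = f₂ g) :
    ∫ g, f₁ g ∂(α.measure x) = ∫ g, f₂ g ∂(α.measure x) :=
  integral_congr_ae ((α.ae_mem_fibre x).mono h)

lemma continuous_integral_real {f : G₁ → ℝ} (hf : Continuous f) (hc : HasCompactSupport f) :
    Continuous fun x => ∫ g, f g ∂(α.measure x) := by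
  let A : C_c(G₁, ℂ) := ⟨⟨fun h => (f h : ℂ), by fun_prop⟩,
    hc.comp_left (g := fun t : ℝ => (t : ℂ)) (by simp)⟩
  refine (Complex.continuous_re.comp (α.continuous_integral A)).congr fun x => ?_
  change (∫ h, (f h : ℂ) ∂(α.measure x)).re = _
  rw [integral_complex_ofReal, Complex.ofReal_re]

lemma exists_integral_le {f : G₁ → ℝ} (hf : Continuous f) (hc : HasCompactSupport f) :
    ∃ N, 0 ≤ N ∧ ∀ x, ∫ g, f g ∂(α.measure x) ≤ N := by
  obtain ⟨N, hN⟩ := ((hc.isCompact.image G.continuous_r).image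
    (α.continuous_integral_real hf hc)).bddAbove
  refine ⟨max N 0, le_max_right _ _, fun x => ?_⟩
  by_cases hx : x ∈ G.r '' tsupport f
  · exact (hN ⟨x, hx, rfl⟩).trans (le_max_left _ _)
  · refine le_trans (le_of_eq ?_) (le_max_right _ _)
    rw [α.integral_congr_fibre (f₂ := fun _ => 0), integral_zero]
    exact fun g hg => image_eq_zero_of_notMem_tsupport fun h => hx ⟨g, h, hg⟩

lemma integrable_real {f : G₁ → ℝ} (hf : Continuous f) (hc : HasCompactSupport f) (x : G₀) :
    Integrable f (α.measure x) := by
  have := α.regular x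
  exact hf.integrable_of_hasCompactSupport hc

/-- The Haar measures of a compact set are uniformly bounded; the bound is expressed by a
compactly supported continuous function that dominates the indicator function. -/
lemma exists_bump [T2Space G₁] [LocallyCompactSpace G₁] {K : Set G₁} (hK : IsCompact K) :
    ∃ χ : G₁ → ℝ, Continuous χ ∧ HasCompactSupport χ ∧ (∀ g ∈ K, χ g = 1) ∧ (∀ g, 0 ≤ χ g) ∧
      ∃ N, 0 ≤ N ∧ ∀ x, ∫ g, χ g ∂(α.measure x) ≤ N := by
  obtain ⟨χ, h1, -, hc, h2⟩ := exists_continuous_one_zero_of_isCompact hK isClosed_empty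
    (Set.disjoint_empty K)
  exact ⟨χ, χ.continuous, hc, fun g hg => h1 hg, fun g => (h2 g).1,
    α.exists_integral_le χ.continuous hc⟩

/-- Integration of a function of two arrows over the second one depends continuously on both the
remaining arrow and the fibre. -/
lemma continuous_integral_prod [T2Space G₁] [LocallyCompactSpace G₁] (Ψ : C_c(G₁ × G₁, ℂ)) :
    Continuous fun p : G₀ × G₁ => ∫ g, Ψ (p.2, g) ∂(α.measure p.1) := by
  have hK : IsCompact (Prod.snd '' tsupport Ψ) :=
    Ψ.hasCompactSupport.isCompact.image continuous_snd
  have h0 : ∀ h, ∀ g ∉ Prod.snd '' tsupport Ψ, Ψ (h, g) = 0 := fun h g hg =>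
    image_eq_zero_of_notMem_tsupport fun h => hg ⟨_, h, rfl⟩
  have hcs : ∀ h, HasCompactSupport fun g => Ψ (h, g) := fun h =>
    HasCompactSupport.intro hK (h0 h)
  have hcont : ∀ h, Continuous fun g => Ψ (h, g) := fun h => by
    have := Ψ.continuous
    fun_prop
  let S : G₁ → C_c(G₁, ℂ) := fun h => ⟨⟨_, hcont h⟩, hcs h⟩
  obtain ⟨χ, hχ, hχc, hχ1, hχ0, N, hN, hχN⟩ := α.exists_bump hK
  refine continuous_iff_continuousAt.2 fun ⟨x₀, h₀⟩ => ?_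
  rw [Metric.continuousAt_iff']
  intro ε hε
  have e1 := (Ψ.eventually_forall_norm_sub_lt h₀ (ε := ε / (2 * (N + 1))) (by positivity))
  have e2 := Metric.continuousAt_iff'.1 ((α.continuous_integral (S h₀)).continuousAt (x := x₀))
    (ε / 2) (by positivity)
  filter_upwards [e2.prod_inl_nhds h₀, e1.prod_inr_nhds x₀] with ⟨x, h⟩ h2 h1
  have h3 : dist (∫ g, Ψ (h, g) ∂(α.measure x)) (∫ g, Ψ (h₀, g) ∂(α.measure x)) ≤ ε / 2 := by
    have hsub := integral_sub (α.integrable_cc (S h) x) (α.integrable_cc (S h₀) x)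
    simp only [S, CompactlySupportedContinuousMap.coe_mk, ContinuousMap.coe_mk] at hsub
    rw [dist_eq_norm, ← hsub]
    calc _ ≤ ∫ g, ε / (2 * (N + 1)) * χ g ∂(α.measure x) := by
          refine norm_integral_le_of_norm_le ((α.integrable_real hχ hχc x).const_mul _)
            (ae_of_all _ fun g => ?_)
          by_cases hg : g ∈ Prod.snd '' tsupport Ψ
          · rw [hχ1 g hg, mul_one]; exact (h1 g).le
          · change ‖Ψ (h, g) - Ψ (h₀, g)‖ ≤ _
            rw [h0 _ g hg, h0 _ g hg, sub_zero, norm_zero]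
            exact mul_nonneg (by positivity) (hχ0 g)
      _ ≤ ε / (2 * (N + 1)) * (N + 1) := by
          rw [integral_const_mul]
          exact mul_le_mul_of_nonneg_left ((hχN x).trans (by linarith)) (by positivity)
      _ = ε / 2 := by field_simp
  calc _ ≤ dist (∫ g, Ψ (h, g) ∂(α.measure x)) (∫ g, Ψ (h₀, g) ∂(α.measure x))
        + dist (∫ g, Ψ (h₀, g) ∂(α.measure x)) (∫ g, Ψ (h₀, g) ∂(α.measure x₀)) :=
          dist_triangle _ _ _
    _ < ε / 2 + ε / 2 := add_lt_add_of_le_of_lt h3 h2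
    _ = ε := by ring

variable [T2Space G₀] [T2Space G₁] [LocallyCompactSpace G₁]

/-- Left invariance for functions that are only defined on a fibre. -/
lemma left_invariant_of_continuousOn {f : G₁ → ℂ} {g : G₁} {K : Set G₁} (hK : IsCompact K)
    (hf : ContinuousOn f {h | G.r h = G.r g}) (h0 : ∀ h, G.r h = G.r g → h ∉ K → f h = 0) :
    ∫ h, f (G.mul g h) ∂(α.measure (G.s g)) = ∫ h, f h ∂(α.measure (G.r g)) := by
  obtain ⟨φ, hφ⟩ := exists_compactlySupported_extension (G.isClosed_fibre _) hK hf h0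
  rw [α.integral_congr_fibre (f₂ := φ) fun h hh => (hφ h hh).symm, ← α.left_invariant]
  exact α.integral_congr_fibre fun h hh => (hφ _ (G.r_mul _ _ hh.symm)).symm

/-- Fubini's theorem for functions that are only defined on a product of two fibres. -/
lemma integral_swap_of_continuousOn {Θ : G₁ → G₁ → ℂ} {x y : G₀} {K : Set (G₁ × G₁)}
    (hK : IsCompact K)
    (hΘ : ContinuousOn (fun p : G₁ × G₁ => Θ p.1 p.2) {p | G.r p.1 = x ∧ G.r p.2 = y})
    (h0 : ∀ g h, G.r g = x → G.r h = y → (g, h) ∉ K → Θ g h = 0) :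
    ∫ g, ∫ h, Θ g h ∂(α.measure y) ∂(α.measure x)
      = ∫ h, ∫ g, Θ g h ∂(α.measure x) ∂(α.measure y) := by
  have hcl : IsClosed {p : G₁ × G₁ | G.r p.1 = x ∧ G.r p.2 = y} :=
    ((G.isClosed_fibre x).preimage continuous_fst).inter
      ((G.isClosed_fibre y).preimage continuous_snd)
  obtain ⟨φ, hφ⟩ := exists_compactlySupported_extension hcl hK hΘ fun p hp => h0 _ _ hp.1 hp.2
  have := α.regular x
  have := α.regular y
  have key := integral_integral_swap_of_hasCompactSupport (f := fun g h => φ (g, h))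
    (μ := α.measure x) (ν := α.measure y) φ.continuous φ.hasCompactSupport
  rw [α.integral_congr_fibre fun g hg => α.integral_congr_fibre fun h hh =>
    (hφ (g, h) ⟨hg, hh⟩).symm,
    key]
  exact α.integral_congr_fibre fun g hg => α.integral_congr_fibre fun h hh => hφ (h, g) ⟨hh, hg⟩

lemma conv_apply (f₁ f₂ : C_c(G₁, ℂ)) (g : G₁) :
    α.conv f₁ f₂ g = ∫ h, f₁ h * f₂ (G.mul (G.inv h) g) ∂(α.measure (G.r g)) := rfl

lemma conv_add (f k₁ k₂ : C_c(G₁, ℂ)) : α.conv f (k₁ + k₂) = α.conv f k₁ + α.conv f k₂ := by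
  ext g
  simp only [conv_apply, CompactlySupportedContinuousMap.add_apply, mul_add]
  exact integral_add (α.integrable_conv _ _ _) (α.integrable_conv _ _ _)

lemma add_conv (f₁ f₂ k : C_c(G₁, ℂ)) : α.conv (f₁ + f₂) k = α.conv f₁ k + α.conv f₂ k := by
  ext g
  simp only [conv_apply, CompactlySupportedContinuousMap.add_apply, add_mul]
  exact integral_add (α.integrable_conv _ _ _) (α.integrable_conv _ _ _)

lemma conv_smul (c : ℂ) (f k : C_c(G₁, ℂ)) : α.conv f (c • k) = c • α.conv f k := by
  ext g
  simp only [conv_apply, CompactlySupportedContinuousMap.smul_apply, smul_eq_mul,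
    ← integral_const_mul]
  congr 1 with h
  ring

lemma smul_conv (c : ℂ) (f k : C_c(G₁, ℂ)) : α.conv (c • f) k = c • α.conv f k := by
  ext g
  simp only [conv_apply, CompactlySupportedContinuousMap.smul_apply, smul_eq_mul,
    ← integral_const_mul]
  congr 1 with h
  ring

lemma conv_assoc (f g k : C_c(G₁, ℂ)) :
    α.conv (α.conv f g) k = α.conv f (α.conv g k) := by
  ext y
  set x := G.r y with hx
  have hKl := f.hasCompactSupport.isCompact
  have hKg := g.hasCompactSupport.isCompact
  have swap := α.integral_swap_of_continuousOn (x := x) (y := x)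
    (Θ := fun h l => f l * g (G.mul (G.inv l) h) * k (G.mul (G.inv h) y))
    ((G.isCompact_mulSet hKl hKg).prod hKl) ?_ ?_
  · calc α.conv (α.conv f g) k y
        = ∫ h, ∫ l, f l * g (G.mul (G.inv l) h) * k (G.mul (G.inv h) y) ∂(α.measure x)
            ∂(α.measure x) := by
          rw [conv_apply]
          refine α.integral_congr_fibre fun h hh => ?_
          rw [conv_apply, hh, ← integral_mul_const]
      _ = ∫ l, ∫ h, f l * g (G.mul (G.inv l) h) * k (G.mul (G.inv h) y) ∂(α.measure x)
            ∂(α.measure x) := swap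
      _ = α.conv f (α.conv g k) y := by
          rw [conv_apply]
          refine α.integral_congr_fibre fun l hl => ?_
          have hl' : G.r l = G.r y := hl
          simp only [mul_assoc]
          rw [integral_const_mul, conv_apply, G.r_inv_mul hl', ← hl,
            ← α.left_invariant_of_continuousOn (g := l)
              (G.isCompact_mulSet (isCompact_singleton (x := l)) hKg)]
          · congr 1
            refine α.integral_congr_fibre fun h hh => ?_
            rw [G.inv_mul_cancel_left hh.symm, G.inv_mul_rev hh.symm, G.mul_assoc _ _ _
              ((G.s_inv h).trans (hh.trans (G.r_inv l).symm)) ((G.s_inv l).trans hl)]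
          · refine (g.continuous.comp_continuousOn (G.continuousOn_inv_mul continuousOn_const
              continuousOn_id fun h hh => hh.symm)).mul (k.continuous.comp_continuousOn
              (G.continuousOn_inv_mul continuousOn_id continuousOn_const fun h hh => hh.trans hl))
          · intro h hh hn
            rw [image_eq_zero_of_notMem_tsupport (f := g), zero_mul]
            exact fun hm => hn (G.mem_mulSet rfl hh.symm hm)
  · refine ((f.continuous.comp continuous_snd).continuousOn.mul
      (g.continuous.comp_continuousOn (G.continuousOn_inv_mul continuousOn_snd continuousOn_fst
        fun p hp => hp.2.trans hp.1.symm))).mul (k.continuous.comp_continuousOn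
          (G.continuousOn_inv_mul continuousOn_fst continuousOn_const fun p hp => hp.1))
  · intro h l hh hl hn
    by_contra h0
    have h1 : l ∈ tsupport f := subset_tsupport _ fun h => h0 (by simp [h])
    have h2 : G.mul (G.inv l) h ∈ tsupport g := subset_tsupport _ fun h => h0 (by simp [h])
    exact hn ⟨G.mem_mulSet h1 (hl.trans hh.symm) h2, h1⟩

lemma invol_conv (f k : C_c(G₁, ℂ)) :
    G.invol (α.conv f k) = α.conv (G.invol k) (G.invol f) := by
  ext y
  rw [G.invol_apply, conv_apply, conv_apply, ← G.s_inv y]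
  -- substitute `h ↦ y⁻¹ h` in the integral over the fibre of `y⁻¹`
  rw [← α.left_invariant_of_continuousOn (g := G.inv y) f.hasCompactSupport.isCompact]
  · rw [RCLike.star_def, ← integral_conj, G.s_inv]
    refine α.integral_congr_fibre fun h hh => ?_
    have e : G.s (G.inv y) = G.r h := by rw [G.s_inv, hh]
    have e' : G.s (G.inv h) = G.r y := by rw [G.s_inv, hh]
    rw [G.invol_apply, G.invol_apply, G.inv_mul_rev e, G.inv_inv, G.inv_mul_rev e', G.inv_inv,
      G.mul_assoc _ _ _ e' (G.r_inv y).symm, G.mul_inv, ← hh, ← G.s_inv h, G.mul_unit]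
    simp [mul_comm]
  · exact f.continuous.continuousOn.mul (k.continuous.comp_continuousOn
      (G.continuousOn_inv_mul continuousOn_id continuousOn_const fun h hh => hh))
  · intro h _ hn
    rw [image_eq_zero_of_notMem_tsupport hn, zero_mul]

end HaarSystem

/-! ### The convolution pairing and its Riemann sums -/

section

variable {X Y : Type*} [TopologicalSpace X] [TopologicalSpace Y]

/-- The slice `Φ(g, ⬝)` of a function of two arrows. -/
noncomputable def CompactlySupportedContinuousMap.slice [T2Space Y] (Φ : C_c(X × Y, ℂ)) (x : X) :
    C_c(Y, ℂ) where
  toFun y := Φ (x, y)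
  continuous_toFun := by
    have := Φ.continuous
    fun_prop
  hasCompactSupport' :=
    HasCompactSupport.intro (Φ.hasCompactSupport.isCompact.image continuous_snd)
      fun _ hh => image_eq_zero_of_notMem_tsupport fun hm => hh ⟨_, hm, rfl⟩

end

namespace TopologicalGroupoid

variable {G₀ G₁ : Type*} [TopologicalSpace G₀] [TopologicalSpace G₁] (G : TopologicalGroupoid G₀ G₁)

/-- Multiplication by a function on the object space, pulled back along the range map. -/
noncomputable def rangeMul (φ : C(G₀, ℂ)) (f : C_c(G₁, ℂ)) : C_c(G₁, ℂ) where
  toFun g := φ (G.r g) * f g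
  continuous_toFun := (φ.continuous.comp G.continuous_r).mul f.continuous
  hasCompactSupport' := f.hasCompactSupport.mul_left

lemma rangeMul_apply (φ : C(G₀, ℂ)) (f : C_c(G₁, ℂ)) (g : G₁) :
    G.rangeMul φ f g = φ (G.r g) * f g := rfl

end TopologicalGroupoid

section Pairing

variable {G₀ G₁ : Type*} [TopologicalSpace G₀] [TopologicalSpace G₁]
  [MeasurableSpace G₁] [BorelSpace G₁] {G : TopologicalGroupoid G₀ G₁} (α : HaarSystem G)

namespace HaarSystem

/-- The convolution pairing of two functions on `{(g, h) | r g = r h}`: the integral over `g` of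
the convolution products `Φ(g, ⬝)^* * Ψ(g, ⬝)`.  If `Φ` and `Ψ` are thought of as
vectors in the tensor product of the Hilbert module `L²(G¹, r, α)` with a representation, this is
the function whose action computes their inner product. -/
noncomputable def pairing (Φ Ψ : G₁ → G₁ → ℂ) (k : G₁) : ℂ :=
  ∫ h, ∫ g, star (Φ g (G.inv h)) * Ψ g (G.mul (G.inv h) k) ∂(α.measure (G.s h))
    ∂(α.measure (G.r k))

variable {α} in
lemma pairing_congr {Φ Φ' Ψ Ψ' : G₁ → G₁ → ℂ} (hΦ : ∀ g h, G.r g = G.r h → Φ g h = Φ' g h)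
    (hΨ : ∀ g h, G.r g = G.r h → Ψ g h = Ψ' g h) (k : G₁) :
    α.pairing Φ Ψ k = α.pairing Φ' Ψ' k := by
  refine α.integral_congr_fibre fun h hh => α.integral_congr_fibre fun g hg => ?_
  rw [hΦ g _ (by rw [hg, G.r_inv]), hΨ g _ (by rw [hg, G.r_inv_mul hh])]

lemma integrable_star_mul (Φ Ψ : C_c(G₁ × G₁, ℂ)) (u v : G₁) (x : G₀) [T2Space G₁] :
    Integrable (fun g => star (Φ (g, u)) * Ψ (g, v)) (α.measure x) := by
  have := α.regular x
  have hc : Continuous fun g => star (Φ (g, u)) * Ψ (g, v) := by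
    have := Φ.continuous
    have := Ψ.continuous
    fun_prop
  refine hc.integrable_of_hasCompactSupport
    (HasCompactSupport.intro (Φ.hasCompactSupport.isCompact.image continuous_fst) fun g hg => ?_)
  rw [image_eq_zero_of_notMem_tsupport fun hm => hg ⟨_, hm, rfl⟩, star_zero, zero_mul]

variable [T2Space G₀] [T2Space G₁] [LocallyCompactSpace G₁]

/-- The outer integrand of a pairing is integrable, so that pairings are not junk values. -/
lemma integrable_pairing (Φ Ψ : C_c(G₁ × G₁, ℂ)) (k : G₁) :
    Integrable (fun h => ∫ g, star (Φ (g, G.inv h)) * Ψ (g, G.mul (G.inv h) k)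
      ∂(α.measure (G.s h))) (α.measure (G.r k)) := by
  have hK1 : IsCompact (Prod.fst '' tsupport Φ) :=
    Φ.hasCompactSupport.isCompact.image continuous_fst
  have hK2 : IsCompact (G.inv '' (Prod.snd '' tsupport Φ)) :=
    (Φ.hasCompactSupport.isCompact.image continuous_snd).image G.continuous_inv
  have hcl : IsClosed {p : G₁ × G₁ | G.r p.1 = G.r k} :=
    (G.isClosed_fibre _).preimage continuous_fst
  have h1 : Continuous fun p : G₁ × G₁ => star (Φ (p.2, G.inv p.1)) := by
    have := G.continuous_inv
    have := Φ.continuous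
    fun_prop
  obtain ⟨φ, hφ⟩ := exists_compactlySupported_extension hcl (hK2.prod hK1)
    (f := fun p => star (Φ (p.2, G.inv p.1)) * Ψ (p.2, G.mul (G.inv p.1) k))
    (h1.continuousOn.mul (Ψ.continuous.comp_continuousOn (continuousOn_snd.prodMk
      (G.continuousOn_inv_mul continuousOn_fst continuousOn_const fun p hp => hp))))
    (fun p _ hp => by
      rw [image_eq_zero_of_notMem_tsupport (f := Φ), star_zero, zero_mul]
      exact fun hm => hp ⟨⟨_, ⟨_, hm, rfl⟩, G.inv_inv _⟩, ⟨_, hm, rfl⟩⟩)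
  have hc : Continuous fun h => ∫ g, φ (h, g) ∂(α.measure (G.s h)) :=
    (α.continuous_integral_prod φ).comp (G.continuous_s.prodMk continuous_id)
  have hcs : HasCompactSupport fun h => ∫ g, φ (h, g) ∂(α.measure (G.s h)) := by
    refine HasCompactSupport.intro (φ.hasCompactSupport.isCompact.image continuous_fst)
      fun h hh => ?_
    rw [← integral_zero G₁ ℂ]
    congr 1 with g
    exact image_eq_zero_of_notMem_tsupport fun hm => hh ⟨_, hm, rfl⟩
  have := α.regular (G.r k)
  refine (hc.integrable_of_hasCompactSupport hcs).congr ?_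
  filter_upwards [α.ae_mem_fibre (G.r k)] with h hh
  congr 1 with g
  exact hφ (h, g) hh

lemma invol_conv_rangeMul_apply (φ : C(G₀, ℂ)) (f₁ f₂ : C_c(G₁, ℂ)) (k : G₁) :
    α.conv (G.invol (G.rangeMul φ f₁)) (G.rangeMul φ f₂) k =
      ∫ h, star (φ (G.s h)) * φ (G.s h) * (G.invol f₁ h * f₂ (G.mul (G.inv h) k))
        ∂(α.measure (G.r k)) := by
  refine α.integral_congr_fibre fun h hh => ?_
  rw [G.invol_apply, G.invol_apply, G.rangeMul_apply, G.rangeMul_apply, G.r_inv, G.r_inv_mul hh,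
    star_mul']
  ring

/-- The convolution pairing is a limit, uniform with supports in a fixed compact set, of Riemann sums
of convolution products `f^* * f`.  For a fine partition of unity `p_m` with sample points `g_m`, the
functions are `f_m(h) = (∫ p_m dα^{r(h)})^½ Φ(g_m, h)`; the square root is what makes the Riemann sum
positive. -/
lemma exists_riemann_sum {n : Type*} [Finite n] (Φ : n → C_c(G₁ × G₁, ℂ)) :
    ∃ K : Set G₁, IsCompact K ∧
      (∀ i j, ∀ k ∉ K, α.pairing (fun g h => Φ i (g, h)) (fun g h => Φ j (g, h)) k = 0) ∧
      ∀ δ > 0, ∃ (t : Finset G₁) (f : t → n → C_c(G₁, ℂ)), ∀ i j,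
        (∀ k ∉ K, (∑ m, α.conv (G.invol (f m i)) (f m j)) k = 0) ∧
        ∀ k, ‖(∑ m, α.conv (G.invol (f m i)) (f m j)) k -
          α.pairing (fun g h => Φ i (g, h)) (fun g h => Φ j (g, h)) k‖ ≤ δ := by
  set K₁ := ⋃ i, Prod.fst '' tsupport (Φ i)
  set K₂ := ⋃ i, Prod.snd '' tsupport (Φ i)
  have hK₁ : IsCompact K₁ := isCompact_iUnion fun i =>
    (Φ i).hasCompactSupport.isCompact.image continuous_fst
  have hK₂ : IsCompact K₂ := isCompact_iUnion fun i =>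
    (Φ i).hasCompactSupport.isCompact.image continuous_snd
  have z₁ : ∀ i, ∀ g ∉ K₁, ∀ h, Φ i (g, h) = 0 := fun i g hg h =>
    image_eq_zero_of_notMem_tsupport fun hm => hg (Set.mem_iUnion.2 ⟨i, _, hm, rfl⟩)
  have z₂ : ∀ i g, ∀ h ∉ K₂, Φ i (g, h) = 0 := fun i g h hh =>
    image_eq_zero_of_notMem_tsupport fun hm => hh (Set.mem_iUnion.2 ⟨i, _, hm, rfl⟩)
  have hiK₂ := hK₂.image G.continuous_inv
  -- all partitions of unity are supported in `K₁'`, which bounds their integrals uniformly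
  obtain ⟨K₁', hK₁', hKK⟩ := exists_compact_superset hK₁
  obtain ⟨χ₁, hχ₁, hχ₁c, hχ₁1, hχ₁0, N₁, hN₁, hχN₁⟩ := α.exists_bump hK₁'
  obtain ⟨χ₂, hχ₂, hχ₂c, hχ₂1, hχ₂0, N₂, hN₂, hχN₂⟩ := α.exists_bump hiK₂
  have hM' : ∃ M, 0 ≤ M ∧ ∀ i p, ‖Φ i p‖ ≤ M := by
    choose B hB using fun i => (Φ i).continuous.bounded_above_of_compact_support
      (Φ i).hasCompactSupport
    obtain ⟨M, hM⟩ := (Set.finite_range B).bddAbove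
    exact ⟨max M 0, le_max_right _ _, fun i p => (hB i p).trans
      ((hM ⟨i, rfl⟩).trans (le_max_left _ _))⟩
  obtain ⟨M, hM, hΦM⟩ := hM'
  have hz : ∀ i j g g' h k, G.r h = G.r k → k ∉ G.mulSet (G.inv '' K₂) K₂ →
      star (Φ i (g, G.inv h)) * Φ j (g', G.mul (G.inv h) k) = 0 := by
    intro i j g g' h k hh hk
    by_cases h1 : G.inv h ∈ K₂
    · rw [z₂ j _ (G.mul (G.inv h) k), mul_zero]
      exact fun h2 => hk (G.mem_mulSet ⟨_, h1, G.inv_inv h⟩ hh h2)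
    · rw [z₂ i _ _ h1, star_zero, zero_mul]
  refine ⟨G.mulSet (G.inv '' K₂) K₂, G.isCompact_mulSet hiK₂ hK₂, ?_, ?_⟩
  · intro i j k hk
    rw [pairing, α.integral_congr_fibre (f₂ := fun _ => 0), integral_zero]
    intro h hh
    simp only [hz i j _ _ h k hh hk, integral_zero]
  intro δ hδ
  set ε := δ / ((2 * M + 1) * (N₁ + 1) * (N₂ + 1)) with hε
  have hε0 : 0 < ε := by positivity
  have hU : ∀ g₀, ∃ U, IsOpen U ∧ g₀ ∈ U ∧
      ∀ g ∈ U, ∀ i h, ‖Φ i (g, h) - Φ i (g₀, h)‖ ≤ ε := by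
    intro g₀
    have : ∀ᶠ g in 𝓝 g₀, ∀ i h, ‖Φ i (g, h) - Φ i (g₀, h)‖ ≤ ε :=
      eventually_all.2 fun i => ((Φ i).eventually_forall_norm_sub_lt g₀ hε0).mono
        fun g hg h => (hg h).le
    obtain ⟨U, hU, hUo, hUg⟩ := eventually_nhds_iff.1 this
    exact ⟨U, hUo, hUg, hU⟩
  choose U hUo hUg hUΦ using hU
  obtain ⟨t, p, hpc, hpcs, hp0, hpU, hp1, hp1'⟩ := exists_finite_partition hK₁ hKK hUo hUg
  have hPc : ∀ m, Continuous fun x => ∫ g, p m g ∂(α.measure x) := fun m =>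
    α.continuous_integral_real (hpc m) (hpcs m)
  let φ : t → C(G₀, ℂ) := fun m =>
    ⟨fun x => (√(∫ g, p m g ∂(α.measure x)) : ℝ), by have := hPc m; fun_prop⟩
  have hφ : ∀ m x, star (φ m x) * φ m x = ∫ g, (p m g : ℂ) ∂(α.measure x) := by
    intro m x
    change star ((√(∫ g, p m g ∂(α.measure x)) : ℝ) : ℂ) *
      ((√(∫ g, p m g ∂(α.measure x)) : ℝ) : ℂ) = _
    rw [RCLike.star_def, Complex.conj_ofReal, ← Complex.ofReal_mul,
      Real.mul_self_sqrt (integral_nonneg (hp0 m)), integral_complex_ofReal]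
  have hpi : ∀ m x, Integrable (fun g => (p m g : ℂ)) (α.measure x) := fun m x =>
    (α.integrable_real (hpc m) (hpcs m) x).ofReal
  refine ⟨t, fun m i => G.rangeMul (φ m) ((Φ i).slice m), fun i j => ?_⟩
  have hS : ∀ m k, α.conv (G.invol (G.rangeMul (φ m) ((Φ i).slice m)))
      (G.rangeMul (φ m) ((Φ j).slice m)) k = ∫ h, ∫ g, (p m g : ℂ) *
        (star (Φ i (m, G.inv h)) * Φ j (m, G.mul (G.inv h) k)) ∂(α.measure (G.s h))
          ∂(α.measure (G.r k)) := by
    intro m k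
    rw [invol_conv_rangeMul_apply]
    congr 1 with h
    rw [integral_mul_const, hφ]
    rfl
  have hSi : ∀ m k, Integrable (fun h => ∫ g, (p m g : ℂ) *
        (star (Φ i (m, G.inv h)) * Φ j (m, G.mul (G.inv h) k)) ∂(α.measure (G.s h)))
          (α.measure (G.r k)) := by
    intro m k
    refine (α.integrable_conv (G.invol (G.rangeMul (φ m) ((Φ i).slice m)))
      (G.rangeMul (φ m) ((Φ j).slice m)) k).congr ?_
    filter_upwards [α.ae_mem_fibre (G.r k)] with h hh
    rw [integral_mul_const, ← hφ, G.invol_apply, G.rangeMul_apply, G.rangeMul_apply, G.r_inv,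
      G.r_inv_mul hh, star_mul']
    change _ * star (Φ i (m, G.inv h)) * (_ * Φ j (m, G.mul (G.inv h) k)) = _
    ring
  constructor
  · intro k hk
    rw [CompactlySupportedContinuousMap.sum_apply]
    refine Finset.sum_eq_zero fun m _ => ?_
    rw [hS, α.integral_congr_fibre (f₂ := fun _ => 0), integral_zero]
    intro h hh
    simp only [hz i j _ _ h k hh hk, mul_zero, integral_zero]
  intro k
  -- the integrands differ by at most `2 M ε`, and they are supported in fixed compact sets
  have pt : ∀ g u v, ‖(∑ m, (p m g : ℂ) * (star (Φ i (m, u)) * Φ j (m, v))) -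
      star (Φ i (g, u)) * Φ j (g, v)‖ ≤ 2 * M * ε * χ₁ g := by
    intro g u v
    -- outside `K₁`, where the `p_m` need not sum to `1`, both sides vanish
    have e1 : star (Φ i (g, u)) * Φ j (g, v)
        = ∑ m, (p m g : ℂ) * (star (Φ i (g, u)) * Φ j (g, v)) := by
      rw [← Finset.sum_mul, ← Complex.ofReal_sum]
      by_cases hg : g ∈ K₁
      · rw [hp1 g hg]; simp
      · rw [z₁ i g hg]; simp
    rw [e1, ← Finset.sum_sub_distrib]
    have e2 : ∀ m : t, ‖(p m g : ℂ) * (star (Φ i (m, u)) * Φ j (m, v)) -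
        (p m g : ℂ) * (star (Φ i (g, u)) * Φ j (g, v))‖ ≤ p m g * (2 * M * ε) := by
      intro m
      rw [← mul_sub, norm_mul, Complex.norm_real, Real.norm_of_nonneg (hp0 m g)]
      by_cases hm : p m g = 0
      · simp [hm]
      refine mul_le_mul_of_nonneg_left ?_ (hp0 m g)
      have hgU := hUΦ m g (hpU m g hm).1
      have e3 : star (Φ i (m, u)) * Φ j (m, v) - star (Φ i (g, u)) * Φ j (g, v) =
          -(star (Φ i (g, u) - Φ i (m, u)) * Φ j (m, v)) -
            star (Φ i (g, u)) * (Φ j (g, v) - Φ j (m, v)) := by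
        rw [star_sub]; ring
      rw [e3]
      refine (norm_sub_le _ _).trans ?_
      rw [norm_neg, norm_mul, norm_mul, norm_star, norm_star]
      have := mul_le_mul (hgU i u) (hΦM j (m, v)) (norm_nonneg _) hε0.le
      have := mul_le_mul (hΦM i (g, u)) (hgU j v) (norm_nonneg _) hM
      linarith
    refine (norm_sum_le _ _).trans ((Finset.sum_le_sum fun m _ => e2 m).trans ?_)
    rw [← Finset.sum_mul, mul_comm]
    refine mul_le_mul_of_nonneg_left ?_ (by positivity)
    by_cases hg : g ∈ K₁'
    · rw [hχ₁1 g hg]; exact hp1' g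
    · refine le_trans (le_of_eq (Finset.sum_eq_zero fun m _ => ?_)) (hχ₁0 g)
      by_contra hne
      exact hg (hpU m g hne).2
  rw [CompactlySupportedContinuousMap.sum_apply, Finset.sum_congr rfl fun m _ => hS m k,
    ← integral_finsetSum _ fun m _ => hSi m k, pairing,
    ← integral_sub (integrable_finsetSum _ fun m _ => hSi m k) (α.integrable_pairing _ _ k)]
  have hin : ∀ h, ‖(∑ m, ∫ g, (p m g : ℂ) *
      (star (Φ i (m, G.inv h)) * Φ j (m, G.mul (G.inv h) k)) ∂(α.measure (G.s h))) -
      ∫ g, star (Φ i (g, G.inv h)) * Φ j (g, G.mul (G.inv h) k) ∂(α.measure (G.s h))‖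
        ≤ 2 * M * ε * N₁ * χ₂ h := by
    intro h
    by_cases hh : G.inv h ∈ K₂
    · rw [hχ₂1 h ⟨_, hh, G.inv_inv h⟩, mul_one,
        ← integral_finsetSum _ fun m _ => (hpi m _).mul_const _,
        ← integral_sub (integrable_finsetSum _ fun m _ => (hpi m _).mul_const _)
          (α.integrable_star_mul _ _ _ _ _)]
      refine (norm_integral_le_of_norm_le ((α.integrable_real hχ₁ hχ₁c _).const_mul (2 * M * ε))
        (ae_of_all _ fun g => pt g _ _)).trans ?_
      rw [integral_const_mul]
      exact mul_le_mul_of_nonneg_left (hχN₁ _) (by positivity)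
    · simp only [z₂ i _ _ hh, star_zero, zero_mul, mul_zero, integral_zero, Finset.sum_const_zero,
        sub_zero, norm_zero]
      exact mul_nonneg (by positivity) (hχ₂0 h)
  refine (norm_integral_le_of_norm_le ((α.integrable_real hχ₂ hχ₂c _).const_mul
    (2 * M * ε * N₁)) (ae_of_all _ hin)).trans ?_
  rw [integral_const_mul]
  calc 2 * M * ε * N₁ * ∫ h, χ₂ h ∂(α.measure (G.r k))
      ≤ (2 * M + 1) * ε * (N₁ + 1) * (N₂ + 1) := by
        have := hχN₂ (G.r k)
        have h1 : (∫ h, χ₂ h ∂(α.measure (G.r k))) ≤ N₂ + 1 := by linarith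
        have h2 : 0 ≤ ∫ h, χ₂ h ∂(α.measure (G.r k)) := integral_nonneg hχ₂0
        gcongr <;> linarith
    _ = δ := by rw [hε]; field_simp

end HaarSystem
end Pairing

/-! ### The `I`-norm and the pairing of translated functions -/

namespace TopologicalGroupoid

variable {G₀ G₁ : Type*} [TopologicalSpace G₀] [TopologicalSpace G₁] (G : TopologicalGroupoid G₀ G₁)

lemma mul_inv_mul_inv_mul {g h k : G₁} (e : G.r g = G.r h) (e' : G.r k = G.r h) :
    G.mul (G.inv (G.mul (G.inv h) g)) (G.mul (G.inv h) k) = G.mul (G.inv g) k := by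
  have e1 : G.s (G.inv h) = G.r g := by rw [G.s_inv, e]
  rw [G.inv_mul_rev e1, G.inv_inv, G.mul_assoc _ _ _ (by rw [G.s_inv, e])
    (by rw [G.r_inv_mul e'.symm]), G.mul_div e'.symm]

lemma inv_inv_mul_mul_inv {g h : G₁} (e : G.r g = G.r h) :
    G.mul (G.inv (G.mul (G.inv h) g)) (G.inv h) = G.inv g := by
  have e1 : G.s (G.inv h) = G.r g := by rw [G.s_inv, e]
  rw [G.inv_mul_rev e1, G.inv_inv, G.mul_assoc _ _ _ (by rw [G.s_inv, e])
    (G.r_inv h).symm, G.mul_inv, ← e, ← G.s_inv g, G.mul_unit]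

lemma inv_mul_mul_cancel {g h : G₁} (e : G.s g = G.r h) :
    G.mul (G.inv (G.mul g h)) g = G.inv h := by
  rw [G.inv_mul_rev e, G.mul_assoc _ _ _ (by rw [G.s_inv, G.r_inv, e]) (G.s_inv g), G.inv_mul, e,
    ← G.s_inv h, G.mul_unit]

lemma exists_extension_translate [T2Space G₀] [T2Space G₁]
    [LocallyCompactSpace G₁] (b k : C_c(G₁, ℂ)) : ∃ Ψ : C_c(G₁ × G₁, ℂ),
    ∀ g h, G.r g = G.r h → Ψ (g, h) = b g * k (G.mul (G.inv g) h) := by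
  have hb := b.hasCompactSupport.isCompact
  obtain ⟨Ψ, hΨ⟩ := exists_compactlySupported_extension
    (C := {p : G₁ × G₁ | G.r p.1 = G.r p.2})
    (isClosed_eq (G.continuous_r.comp continuous_fst) (G.continuous_r.comp continuous_snd))
    (hb.prod (G.isCompact_mulSet hb k.hasCompactSupport.isCompact))
    (f := fun p => b p.1 * k (G.mul (G.inv p.1) p.2))
    ((b.continuous.comp continuous_fst).continuousOn.mul (k.continuous.comp_continuousOn
      (G.continuousOn_inv_mul continuousOn_fst continuousOn_snd fun p hp => hp)))
    (fun p hp hn => by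
      by_contra h0
      have h1 : p.1 ∈ tsupport b := subset_tsupport _ fun h => h0 (by simp [h])
      have h2 : G.mul (G.inv p.1) p.2 ∈ tsupport k := subset_tsupport _ fun h => h0 (by simp [h])
      exact hn ⟨h1, G.mem_mulSet h1 hp h2⟩)
  exact ⟨Ψ, fun g h e => hΨ (g, h) e⟩

end TopologicalGroupoid

namespace HaarSystem

variable {G₀ G₁ : Type*} [TopologicalSpace G₀] [TopologicalSpace G₁]
  [MeasurableSpace G₁] [BorelSpace G₁] {G : TopologicalGroupoid G₀ G₁} (α : HaarSystem G)

/-- The function `x ↦ ∫ |f| dα^x` on the object space. -/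
noncomputable def rangeIntegral (f : C_c(G₁, ℂ)) : C(G₀, ℝ) where
  toFun x := ∫ g, ‖f g‖ ∂(α.measure x)
  continuous_toFun := α.continuous_integral_real f.continuous.norm f.hasCompactSupport.norm

/-- The function `x ↦ ∫ |f(g⁻¹)| dα^x(g)` on the object space. -/
noncomputable def sourceIntegral [T2Space G₁] (f : C_c(G₁, ℂ)) : C(G₀, ℝ) :=
  α.rangeIntegral (G.invol f)

lemma rangeIntegral_apply (f : C_c(G₁, ℂ)) (x : G₀) :
    α.rangeIntegral f x = ∫ g, ‖f g‖ ∂(α.measure x) := rfl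

lemma sourceIntegral_apply [T2Space G₁] (f : C_c(G₁, ℂ)) (x : G₀) :
    α.sourceIntegral f x = ∫ g, ‖f (G.inv g)‖ ∂(α.measure x) := by
  simp [sourceIntegral, rangeIntegral_apply, G.invol_apply]

/-- The suprema in the `I`-norm are suprema of bounded functions. -/
lemma bddAbove_rangeIntegral (f : C_c(G₁, ℂ)) : BddAbove (Set.range (α.rangeIntegral f)) := by
  obtain ⟨N, -, hN⟩ := α.exists_integral_le f.continuous.norm f.hasCompactSupport.norm
  exact ⟨N, by rintro _ ⟨x, rfl⟩; exact hN x⟩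

lemma iNorm_eq [T2Space G₁] (f : C_c(G₁, ℂ)) :
    α.iNorm f = max (⨆ x, α.rangeIntegral f x) (⨆ x, α.sourceIntegral f x) := by
  rw [iNorm]
  congr 2 with x
  rw [sourceIntegral_apply]
  exact integral_map G.continuous_inv.measurable.aemeasurable
    f.continuous.norm.aestronglyMeasurable

lemma rangeIntegral_le_iNorm [T2Space G₁] (f : C_c(G₁, ℂ)) (x : G₀) :
    α.rangeIntegral f x ≤ α.iNorm f := by
  rw [iNorm_eq]
  exact (le_ciSup (α.bddAbove_rangeIntegral f) x).trans (le_max_left _ _)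

lemma sourceIntegral_le_iNorm [T2Space G₁] (f : C_c(G₁, ℂ)) (x : G₀) :
    α.sourceIntegral f x ≤ α.iNorm f := by
  rw [iNorm_eq]
  exact (le_ciSup (α.bddAbove_rangeIntegral _) x).trans (le_max_right _ _)

lemma iNorm_nonneg [T2Space G₁] (f : C_c(G₁, ℂ)) : 0 ≤ α.iNorm f := by
  rw [iNorm_eq]
  exact le_max_of_le_left (Real.iSup_nonneg fun x => integral_nonneg fun g => norm_nonneg _)

/-- On functions with support in a fixed compact set, the `I`-norm is dominated by the supremum
norm. -/
lemma exists_iNorm_le [T2Space G₁] [LocallyCompactSpace G₁] {K : Set G₁} (hK : IsCompact K) :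
    ∃ N, 0 ≤ N ∧ ∀ f : C_c(G₁, ℂ), tsupport f ⊆ K → ∀ M, 0 ≤ M → (∀ g, ‖f g‖ ≤ M) →
      α.iNorm f ≤ N * M := by
  obtain ⟨χ, hχ, hχc, hχ1, hχ0, N, hN, hχN⟩ := α.exists_bump (hK.union (hK.image G.continuous_inv))
  refine ⟨N, hN, fun f hf M hM hfM => ?_⟩
  have key : ∀ k : C_c(G₁, ℂ), (∀ g, ‖k g‖ ≤ M) →
      (∀ g ∉ K ∪ G.inv '' K, k g = 0) → ⨆ x, α.rangeIntegral k x ≤ N * M := by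
    intro k hk hk0
    refine Real.iSup_le (fun x => ?_) (by positivity)
    calc α.rangeIntegral k x ≤ ∫ g, χ g * M ∂(α.measure x) := by
          refine integral_mono (α.integrable_cc k x).norm
            ((α.integrable_real hχ hχc x).mul_const M) fun g => ?_
          by_cases hg : g ∈ K ∪ G.inv '' K
          · simpa [hχ1 g hg] using hk g
          · simpa [hk0 g hg] using mul_nonneg (hχ0 g) hM
      _ ≤ N * M := by
          rw [integral_mul_const]
          exact mul_le_mul_of_nonneg_right (hχN x) hM
  rw [iNorm_eq]
  refine max_le (key f hfM fun g hg => ?_) (key _ (fun g => ?_) fun g hg => ?_)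
  · exact image_eq_zero_of_notMem_tsupport fun h => hg (Or.inl (hf h))
  · rw [G.invol_apply, norm_star]; exact hfM _
  · rw [G.invol_apply, image_eq_zero_of_notMem_tsupport (f := f), star_zero]
    exact fun h => hg (Or.inr ⟨_, hf h, G.inv_inv g⟩)

variable [T2Space G₀] [T2Space G₁] [LocallyCompactSpace G₁]

/-- If `U` denotes the translation `(U Φ)(g, h) = Φ(g, g⁻¹ h)`, then `U (b ⊗ k)` has the inner
products that `b ⊗ k` has in the tensor product with the `L²`-module of the right Haar system.  This
combines left invariance and Fubini's theorem. -/
lemma pairing_translate (b k₁ k₂ : C_c(G₁, ℂ)) (B : C(G₀, ℂ))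
    (hB : ∀ x, B x = ∫ g, star (b (G.inv g)) * b (G.inv g) ∂(α.measure x)) (k : G₁) :
    α.pairing (fun g h => b g * k₁ (G.mul (G.inv g) h)) (fun g h => b g * k₂ (G.mul (G.inv g) h)) k
      = α.conv (G.invol k₁) (G.rangeMul B k₂) k := by
  have hb := b.hasCompactSupport.isCompact
  have hk := k₁.hasCompactSupport.isCompact
  have hbi := hb.image G.continuous_inv
  have hki := hk.image G.continuous_inv
  let Θ : G₁ → G₁ → ℂ := fun h g => star (b (G.mul (G.inv h) g) * k₁ (G.inv g)) *
    (b (G.mul (G.inv h) g) * k₂ (G.mul (G.inv g) k))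
  calc _ = ∫ h, ∫ g, Θ h g ∂(α.measure (G.r k)) ∂(α.measure (G.r k)) := by
        -- substitute `g ↦ h⁻¹ g` in the inner integral
        refine α.integral_congr_fibre fun h hh => ?_
        have := α.left_invariant_of_continuousOn (g := G.inv h) hb
          (f := fun g => star (b g * k₁ (G.mul (G.inv g) (G.inv h))) *
            (b g * k₂ (G.mul (G.inv g) (G.mul (G.inv h) k)))) ?_ ?_
        · rw [G.s_inv, G.r_inv, hh] at this
          rw [← this]
          refine α.integral_congr_fibre fun g hg => ?_
          have e : G.r g = G.r h := hg.trans hh.symm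
          rw [G.inv_inv_mul_mul_inv e, G.mul_inv_mul_inv_mul e hh.symm]
        · refine (continuous_star.comp_continuousOn (b.continuous.continuousOn.mul
            (k₁.continuous.comp_continuousOn (G.continuousOn_inv_mul continuousOn_id
              continuousOn_const fun g hg => hg)))).mul (b.continuous.continuousOn.mul
            (k₂.continuous.comp_continuousOn (G.continuousOn_inv_mul continuousOn_id
              continuousOn_const fun g hg => ?_)))
          rw [G.r_inv_mul hh, ← G.r_inv]
          exact hg
        · intro g _ hg
          simp [image_eq_zero_of_notMem_tsupport hg]
    _ = ∫ g, ∫ h, Θ h g ∂(α.measure (G.r k)) ∂(α.measure (G.r k)) := by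
        refine α.integral_swap_of_continuousOn
          ((G.isCompact_mulSet hki hbi).prod hki) ?_ ?_
        · have c1 : ContinuousOn (fun p : G₁ × G₁ => b (G.mul (G.inv p.1) p.2))
              {p | G.r p.1 = G.r k ∧ G.r p.2 = G.r k} :=
            b.continuous.comp_continuousOn (G.continuousOn_inv_mul continuousOn_fst
              continuousOn_snd fun p hp => hp.1.trans hp.2.symm)
          have c2 : Continuous fun p : G₁ × G₁ => k₁ (G.inv p.2) :=
            k₁.continuous.comp (G.continuous_inv.comp continuous_snd)
          exact (continuous_star.comp_continuousOn (c1.mul c2.continuousOn)).mul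
            (c1.mul (k₂.continuous.comp_continuousOn (G.continuousOn_inv_mul continuousOn_snd
              continuousOn_const fun p hp => hp.2)))
        · intro h g hh hg hn
          by_contra h0
          have h1 : b (G.mul (G.inv h) g) ≠ 0 := fun h => h0 (by simp [Θ, h])
          have h2 : k₁ (G.inv g) ≠ 0 := fun h => h0 (by simp [Θ, h])
          have e : G.r g = G.r h := hg.trans hh.symm
          have h3 : g ∈ G.inv '' tsupport k₁ := ⟨_, subset_tsupport _ h2, G.inv_inv g⟩
          refine hn ⟨G.mem_mulSet h3 e ⟨_, subset_tsupport _ h1, ?_⟩, h3⟩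
          rw [G.inv_mul_rev (by rw [G.s_inv, e]), G.inv_inv]
    _ = _ := by
        -- substitute `h ↦ g h` in the integral over `h`, which becomes `B (s g)`
        refine α.integral_congr_fibre fun g hg => ?_
        have := α.left_invariant_of_continuousOn (g := g)
          (G.isCompact_mulSet (isCompact_singleton (x := g)) hbi)
          (f := fun h => star (b (G.mul (G.inv h) g)) * b (G.mul (G.inv h) g)) ?_ ?_
        · have e1 : ∀ h, Θ h g = (star (b (G.mul (G.inv h) g)) * b (G.mul (G.inv h) g)) *
              (star (k₁ (G.inv g)) * k₂ (G.mul (G.inv g) k)) := fun h => by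
            simp only [Θ, star_mul']
            ring
          rw [G.invol_apply, G.rangeMul_apply, G.r_inv_mul hg, hB, mul_left_comm, ← hg]
          simp only [e1]
          rw [integral_mul_const, ← this]
          congr 1
          refine α.integral_congr_fibre fun h hh => ?_
          rw [G.inv_mul_mul_cancel hh.symm]
        · have c1 : ContinuousOn (fun h : G₁ => b (G.mul (G.inv h) g)) {h | G.r h = G.r g} :=
            b.continuous.comp_continuousOn (G.continuousOn_inv_mul continuousOn_id
              continuousOn_const fun h hh => hh)
          exact (continuous_star.comp_continuousOn c1).mul c1
        · intro h hh hn
          by_contra h0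
          have h1 : b (G.mul (G.inv h) g) ≠ 0 := fun h => h0 (by simp [h])
          refine hn (G.mem_mulSet rfl hh.symm ⟨_, subset_tsupport _ h1, ?_⟩)
          rw [G.inv_mul_rev (by rw [G.s_inv, hh]), G.inv_inv]

/-- Multiplication by the square root of a nonnegative function turns convolution products `f^* * f`
into weighted ones. -/
lemma invol_conv_rangeMul_sqrt (ρ : C(G₀, ℝ)) (hρ : ∀ x, 0 ≤ ρ x) (f₁ f₂ : C_c(G₁, ℂ)) :
    α.conv (G.invol (G.rangeMul ⟨fun x => (√(ρ x) : ℂ), by fun_prop⟩ f₁))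
      (G.rangeMul ⟨fun x => (√(ρ x) : ℂ), by fun_prop⟩ f₂) =
    α.conv (G.invol f₁) (G.rangeMul ⟨fun x => (ρ x : ℂ), by fun_prop⟩ f₂) := by
  ext k
  rw [invol_conv_rangeMul_apply, conv_apply]
  refine α.integral_congr_fibre fun h hh => ?_
  rw [G.rangeMul_apply, G.r_inv_mul hh]
  change star (√(ρ (G.s h)) : ℂ) * (√(ρ (G.s h)) : ℂ) * _ = _ * ((ρ (G.s h) : ℂ) * _)
  rw [RCLike.star_def, Complex.conj_ofReal, ← Complex.ofReal_mul, Real.mul_self_sqrt (hρ _)]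
  ring

/-- The inner product of `a ⊗ (f * k) - c • U (b ⊗ k)`, where `f = a b` and `U` is translation: the
mixed terms are inner products with `f * k`. -/
lemma exists_pairing_eq {n : Type*} (f : C_c(G₁, ℂ)) (k : n → C_c(G₁, ℂ)) (c : ℝ) :
    ∃ Φ : n → C_c(G₁ × G₁, ℂ), ∀ i j y,
      α.pairing (fun g h => Φ i (g, h)) (fun g h => Φ j (g, h)) y =
        (α.conv (G.invol (α.conv f (k i)))
            (G.rangeMul ⟨fun x => (α.rangeIntegral f x : ℂ), by fun_prop⟩ (α.conv f (k j)))
          - ((2 * c : ℝ) : ℂ) • α.conv (G.invol (α.conv f (k i))) (α.conv f (k j))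
          + ((c ^ 2 : ℝ) : ℂ) • α.conv (G.invol (k i))
            (G.rangeMul ⟨fun x => (α.sourceIntegral f x : ℂ), by fun_prop⟩ (k j))) y := by
  -- `a = |f|^½` and `b = f / |f|^½`
  have hbc : Continuous fun z : ℂ => z / (√‖z‖ : ℂ) := by
    refine continuous_iff_continuousAt.2 fun z => ?_
    by_cases hz : z = 0
    · subst hz
      have : Tendsto (fun z : ℂ => √‖z‖) (𝓝 0) (𝓝 0) := by
        have h : Continuous fun z : ℂ => √‖z‖ := by fun_prop
        simpa using h.tendsto 0
      rw [ContinuousAt, zero_div]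
      refine squeeze_zero_norm (fun z => ?_) this
      rw [norm_div, Complex.norm_real, Real.norm_of_nonneg (Real.sqrt_nonneg _), Real.div_sqrt]
    · refine ContinuousAt.div continuousAt_id (by fun_prop) ?_
      simpa [Real.sqrt_eq_zero] using hz
  let a : C_c(G₁, ℂ) := ⟨⟨fun g => (√‖f g‖ : ℂ), by fun_prop⟩,
    f.hasCompactSupport.comp_left (g := fun z : ℂ => (√‖z‖ : ℂ)) (by simp)⟩
  let b : C_c(G₁, ℂ) := ⟨⟨fun g => f g / (√‖f g‖ : ℂ), hbc.comp f.continuous⟩,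
    f.hasCompactSupport.comp_left (g := fun z : ℂ => z / (√‖z‖ : ℂ)) (by simp)⟩
  have ha : ∀ g, star (a g) = a g := fun g => Complex.conj_ofReal _
  have haa : ∀ g, a g * a g = (‖f g‖ : ℂ) := fun g => by
    change (√‖f g‖ : ℂ) * (√‖f g‖ : ℂ) = _
    rw [← Complex.ofReal_mul, Real.mul_self_sqrt (norm_nonneg _)]
  have hab : ∀ g, a g * b g = f g := fun g => by
    change (√‖f g‖ : ℂ) * (f g / (√‖f g‖ : ℂ)) = f g
    by_cases h : f g = 0
    · simp [h]
    · field_simp [show (√‖f g‖ : ℂ) ≠ 0 by simpa [Real.sqrt_eq_zero] using h]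
  have hbb : ∀ g, star (b g) * b g = (‖f g‖ : ℂ) := fun g => by
    have hn : ‖b g‖ * ‖b g‖ = ‖f g‖ := by
      change ‖f g / (√‖f g‖ : ℂ)‖ * ‖f g / (√‖f g‖ : ℂ)‖ = _
      rw [norm_div, Complex.norm_real, Real.norm_of_nonneg (Real.sqrt_nonneg _), Real.div_sqrt,
        Real.mul_self_sqrt (norm_nonneg _)]
    rw [RCLike.star_def, Complex.conj_mul', ← hn]
    push_cast
    ring
  choose Ψ hΨ using fun i => G.exists_extension_translate b (k i)
  let w : n → C_c(G₁, ℂ) := fun i => α.conv f (k i)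
  let Φ : n → C_c(G₁ × G₁, ℂ) := fun i =>
    ⟨⟨fun p => a p.1 * w i p.2, by
      have := a.continuous
      have := (w i).continuous
      fun_prop⟩, HasCompactSupport.intro
        (a.hasCompactSupport.isCompact.prod (w i).hasCompactSupport.isCompact) fun p hp => by
          by_contra h0
          exact hp ⟨subset_tsupport _ fun h => h0 (by simp [h]),
            subset_tsupport _ fun h => h0 (by simp [h])⟩⟩ - (c : ℂ) • Ψ i
  have hΦ : ∀ i g h, Φ i (g, h) = a g * w i h - c * Ψ i (g, h) := fun i g h => rfl
  refine ⟨Φ, fun i j y => ?_⟩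
  have tr := α.pairing_translate b (k i) (k j)
    ⟨fun x => (α.sourceIntegral f x : ℂ), by fun_prop⟩ (fun x => by
      change ((α.sourceIntegral f x : ℝ) : ℂ) = _
      simp only [hbb]
      rw [integral_complex_ofReal, sourceIntegral_apply]) y
  rw [← pairing_congr (hΨ i) (hΨ j)] at tr
  rw [CompactlySupportedContinuousMap.add_apply, CompactlySupportedContinuousMap.sub_apply,
    CompactlySupportedContinuousMap.smul_apply, CompactlySupportedContinuousMap.smul_apply, ← tr,
    conv_apply, conv_apply, pairing, pairing, smul_eq_mul, smul_eq_mul, ← integral_const_mul,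
    ← integral_const_mul, ← integral_sub (α.integrable_conv _ _ _)
      ((α.integrable_conv _ _ _).const_mul _)]
  refine Eq.trans ?_ (integral_add ((α.integrable_conv _ _ _).sub
      ((α.integrable_conv _ _ _).const_mul _)) ((α.integrable_pairing _ _ _).const_mul _))
  refine α.integral_congr_fibre fun h hh => ?_
  set u := G.inv h
  set v := G.mul (G.inv h) y
  have hu : G.r u = G.s h := G.r_inv h
  have hv : G.r v = G.s h := G.r_inv_mul hh
  -- the four terms of the inner integral
  have t0 : ∫ g, (‖f g‖ : ℂ) * (star (w i u) * w j v) ∂(α.measure (G.s h)) =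
      α.rangeIntegral f (G.s h) * (star (w i u) * w j v) := by
    rw [integral_mul_const, integral_complex_ofReal]; rfl
  have t1 : ∫ g, star (w i u) * (f g * k j (G.mul (G.inv g) v)) ∂(α.measure (G.s h)) =
      star (w i u) * w j v := by
    rw [integral_const_mul, ← hv]; rfl
  have t2 : ∫ g, star (f g * k i (G.mul (G.inv g) u)) * w j v ∂(α.measure (G.s h)) =
      star (w i u) * w j v := by
    rw [integral_mul_const, ← hu]
    congr 1
    exact integral_conj
  have j0 : Integrable (fun g => (‖f g‖ : ℂ) * (star (w i u) * w j v)) (α.measure (G.s h)) :=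
    (α.integrable_cc f _).norm.ofReal.mul_const _
  have j1 : Integrable (fun g => star (w i u) * (f g * k j (G.mul (G.inv g) v)))
      (α.measure (G.s h)) := by
    rw [← hv]; exact (α.integrable_conv f (k j) v).const_mul _
  have j2 : Integrable (fun g => star (f g * k i (G.mul (G.inv g) u)) * w j v)
      (α.measure (G.s h)) := by
    rw [← hu]; exact ((Complex.conjCLE.toContinuousLinearMap.integrable_comp
      (α.integrable_conv f (k i) u)).mul_const _ :)
  have j3 : Integrable (fun g => star (Ψ i (g, u)) * Ψ j (g, v)) (α.measure (G.s h)) :=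
    α.integrable_star_mul _ _ _ _ _
  calc ∫ g, star (Φ i (g, u)) * Φ j (g, v) ∂(α.measure (G.s h))
      = ∫ g, (‖f g‖ : ℂ) * (star (w i u) * w j v)
          - c * (star (w i u) * (f g * k j (G.mul (G.inv g) v)))
          - c * (star (f g * k i (G.mul (G.inv g) u)) * w j v)
          + c ^ 2 * (star (Ψ i (g, u)) * Ψ j (g, v)) ∂(α.measure (G.s h)) := by
        refine α.integral_congr_fibre fun g hg => ?_
        rw [hΦ, hΦ, hΨ i g u (hg.trans hu.symm), hΨ j g v (hg.trans hv.symm), ← haa, ← hab]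
        simp only [star_sub, star_mul', ha, RCLike.star_def, Complex.conj_ofReal]
        ring
    _ = _ := by
        refine (integral_add ((j0.sub (j1.const_mul _)).sub (j2.const_mul _))
          (j3.const_mul _)).trans ?_
        rw [integral_sub' (j0.sub (j1.const_mul _)) (j2.const_mul _),
          integral_sub' j0 (j1.const_mul _), integral_const_mul (c : ℂ),
          integral_const_mul (c : ℂ), integral_const_mul ((c : ℂ) ^ 2), t0, t1, t2,
          G.rangeMul_apply, G.r_inv_mul hh, G.invol_apply]
        change _ = star (w i u) * ((α.rangeIntegral f (G.s h) : ℂ) * w j v) -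
          ((2 * c : ℝ) : ℂ) * (star (w i u) * w j v) + _
        push_cast
        ring

end HaarSystem

/-! ### The inductive limit topology -/

section InductiveLimit

variable {X E : Type*} [TopologicalSpace X] [NormedAddCommGroup E] [NormedSpace ℂ E]

/-- Continuity of a linear map on `C_c(X)` along uniform convergence with supports in a fixed
compact set. -/
def IsCompactlyContinuous (ℓ : C_c(X, ℂ) →ₗ[ℂ] E) : Prop :=
  ∀ K : Set X, IsCompact K → ∀ ε > 0, ∃ δ > 0, ∀ f : C_c(X, ℂ), (∀ x ∉ K, f x = 0) →
    (∀ x, ‖f x‖ ≤ δ) → ‖ℓ f‖ ≤ ε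

lemma isCompactlyContinuous_of_continuous [T2Space X] {ℓ : C_c(X, ℂ) →ₗ[ℂ] E}
    (h : Continuous[inductiveLimitTopology X, inferInstance] ℓ) : IsCompactlyContinuous ℓ := by
  intro K hK ε hε
  have hincl : @Continuous {f : C_c(X, ℂ) // tsupport f ⊆ K} _ (supNormTopology K)
      (inductiveLimitTopology X) Subtype.val :=
    continuous_sInf_rng.2 fun t ht => ht.2.2.2 K hK
  let _ : TopologicalSpace {f : C_c(X, ℂ) // tsupport f ⊆ K} := supNormTopology K
  have hc : Continuous fun f : {f : C_c(X, ℂ) // tsupport f ⊆ K} => ℓ f.1 :=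
    @Continuous.comp _ _ _ _ (inductiveLimitTopology X) _ _ _ h hincl
  let z : {f : C_c(X, ℂ) // tsupport f ⊆ K} := ⟨0, by
    have : tsupport (⇑(0 : C_c(X, ℂ))) = ∅ := tsupport_eq_empty_iff.2 rfl
    rw [this]; exact Set.empty_subset K⟩
  have h1 : (fun f : {f : C_c(X, ℂ) // tsupport f ⊆ K} => ℓ f.1) ⁻¹' Metric.ball 0 ε ∈ 𝓝 z :=
    hc.continuousAt.preimage_mem_nhds (by
      simpa [z] using Metric.ball_mem_nhds (0 : E) hε)
  rw [nhds_induced] at h1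
  obtain ⟨V, hV, hVs⟩ := h1
  obtain ⟨δ, hδ, hδV⟩ := Metric.mem_nhds_iff.1 hV
  refine ⟨δ / 2, by positivity, fun f hf0 hf => ?_⟩
  have hfK : tsupport f ⊆ K := closure_minimal
    (fun x hx => by_contra fun hn => hx (hf0 x hn)) hK.isClosed
  have hm : (⟨f, hfK⟩ : {f : C_c(X, ℂ) // tsupport f ⊆ K}) ∈
      (fun f : {f : C_c(X, ℂ) // tsupport f ⊆ K} => ℓ f.1) ⁻¹' Metric.ball 0 ε := by
    refine hVs (hδV ?_)
    rw [Metric.mem_ball]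
    refine lt_of_le_of_lt ((BoundedContinuousFunction.dist_le (by positivity)).2 fun x => ?_)
      (half_lt_self hδ)
    change dist (f x) 0 ≤ δ / 2
    rw [dist_zero_right]
    exact hf x
  have := Metric.mem_ball.1 hm
  rw [dist_zero_right] at this
  exact this.le

/-- A linear map on `C_c(X)` that is bounded by the supremum norm on functions with support in a
fixed compact set is continuous in the inductive limit topology. -/
lemma continuous_inductiveLimitTopology (ℓ : C_c(X, ℂ) →ₗ[ℂ] E)
    (h : ∀ K : Set X, IsCompact K → ∃ N, ∀ f : C_c(X, ℂ), tsupport f ⊆ K → ∀ M, 0 ≤ M →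
      (∀ x, ‖f x‖ ≤ M) → ‖ℓ f‖ ≤ N * M) :
    Continuous[inductiveLimitTopology X, inferInstance] ℓ := by
  let t : TopologicalSpace C_c(X, ℂ) := TopologicalSpace.induced ℓ inferInstance
  have ht : inductiveLimitTopology X ≤ t := by
    refine sInf_le ⟨topologicalAddGroup_induced ℓ, continuousSMul_induced ℓ, ?_, ?_⟩
    · exact LocallyConvexSpace.induced (ℓ.restrictScalars ℝ)
    · intro K hK
      let _ : TopologicalSpace {f : C_c(X, ℂ) // tsupport f ⊆ K} := supNormTopology K
      refine continuous_induced_rng.2 (continuous_iff_continuousAt.2 fun f₀ => ?_)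
      obtain ⟨N, hN⟩ := h K hK
      have hd : Tendsto (fun f : {f : C_c(X, ℂ) // tsupport f ⊆ K} =>
          N * dist f.1.toBoundedContinuousFunction f₀.1.toBoundedContinuousFunction)
          (𝓝 f₀) (𝓝 0) := by
        have hc : Continuous fun f : {f : C_c(X, ℂ) // tsupport f ⊆ K} =>
            N * dist f.1.toBoundedContinuousFunction f₀.1.toBoundedContinuousFunction :=
          continuous_const.mul (continuous_induced_dom.dist continuous_const)
        simpa using hc.tendsto f₀
      refine tendsto_iff_dist_tendsto_zero.2 (squeeze_zero (fun _ => dist_nonneg) (fun f => ?_) hd)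
      change dist (ℓ f.1) (ℓ f₀.1) ≤ _
      rw [dist_eq_norm, ← map_sub]
      refine hN _ ?_ _ dist_nonneg fun x => ?_
      · exact (tsupport_sub _ _).trans (Set.union_subset f.2 f₀.2)
      · rw [CompactlySupportedContinuousMap.sub_apply, ← dist_eq_norm]
        exact BoundedContinuousFunction.dist_coe_le_dist (f := f.1.toBoundedContinuousFunction)
          (g := f₀.1.toBoundedContinuousFunction) x
  exact continuous_le_dom ht continuous_induced_dom

end InductiveLimit

/-! ### Positivity and the operator inequality -/

section MatrixSum

variable {X n D : Type*} [TopologicalSpace X] [Fintype n] [NonUnitalCStarAlgebra D]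

/-- The sum of the values of a matrix of linear maps at a matrix of functions. -/
noncomputable def matrixSum (ℓ : n → n → C_c(X, ℂ) →ₗ[ℂ] D) :
    (n → n → C_c(X, ℂ)) →ₗ[ℂ] D :=
  ∑ i, ∑ j, ℓ i j ∘ₗ LinearMap.proj j ∘ₗ LinearMap.proj i

lemma matrixSum_apply (ℓ : n → n → C_c(X, ℂ) →ₗ[ℂ] D) (T : n → n → C_c(X, ℂ)) :
    matrixSum ℓ T = ∑ i, ∑ j, ℓ i j (T i j) := by
  simp [matrixSum, LinearMap.sum_apply]

end MatrixSum

section Positivity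

variable {G₀ G₁ : Type*} [TopologicalSpace G₀] [T2Space G₀] [TopologicalSpace G₁] [T2Space G₁]
  [LocallyCompactSpace G₁] [MeasurableSpace G₁] [BorelSpace G₁] {G : TopologicalGroupoid G₀ G₁}
  (α : HaarSystem G) {n D : Type*} [Fintype n] [NonUnitalCStarAlgebra D] [PartialOrder D]
  [StarOrderedRing D]

/-- If a matrix of linear maps is positive on all matrices `(f_i^* * f_j)`, then it is positive
on convolution pairings, because these are limits of sums of such matrices. -/
lemma matrixSum_pairing_nonneg {ℓ : n → n → C_c(G₁, ℂ) →ₗ[ℂ] D}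
    (hℓ : ∀ i j, IsCompactlyContinuous (ℓ i j))
    (hpos : ∀ f : n → C_c(G₁, ℂ), 0 ≤ matrixSum ℓ fun i j => α.conv (G.invol (f i)) (f j))
    (Φ : n → C_c(G₁ × G₁, ℂ)) (T : n → n → C_c(G₁, ℂ))
    (hT : ∀ i j k, α.pairing (fun g h => Φ i (g, h)) (fun g h => Φ j (g, h)) k = T i j k) :
    0 ≤ matrixSum ℓ T := by
  obtain ⟨K, hK, hK0, hR⟩ := α.exists_riemann_sum Φ
  have hcl : IsClosed {d : D | 0 ≤ d} := isClosed_Ici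
  refine hcl.closure_subset (Metric.mem_closure_iff.2 fun ε hε => ?_)
  set ε' := ε / (2 * (Fintype.card n * Fintype.card n + 1)) with hε'
  have hε'0 : 0 < ε' := by positivity
  choose δ hδ0 hδ using fun i j => hℓ i j K hK ε' hε'0
  obtain ⟨δ', hδ'0, hδ'⟩ : ∃ δ' > 0, ∀ i j, δ' ≤ δ i j := by
    have : ∀ᶠ d in 𝓝[>] (0 : ℝ), ∀ i j, d ≤ δ i j :=
      eventually_all.2 fun i => eventually_all.2 fun j =>
        nhdsWithin_le_nhds (eventually_le_nhds (hδ0 i j))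
    obtain ⟨d, hd, hd0⟩ := (this.and self_mem_nhdsWithin).exists
    exact ⟨d, hd0, hd⟩
  obtain ⟨t, f, hf⟩ := hR δ' hδ'0
  refine ⟨matrixSum ℓ (fun i j => ∑ m, α.conv (G.invol (f m i)) (f m j)), ?_, ?_⟩
  · have e : (fun i j => ∑ m, α.conv (G.invol (f m i)) (f m j)) =
        ∑ m, fun i j => α.conv (G.invol (f m i)) (f m j) := by
      ext i j : 2
      simp
    rw [e, map_sum]
    exact Finset.sum_nonneg fun m _ => hpos (f m)
  · rw [dist_comm, dist_eq_norm, ← map_sub, matrixSum_apply]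
    have hb : ∀ i j,
        ‖ℓ i j (((fun i j => ∑ m, α.conv (G.invol (f m i)) (f m j)) - T) i j)‖ ≤ ε' := by
      intro i j
      refine hδ i j _ (fun k hk => ?_) fun k => le_trans ?_ (hδ' i j)
      · change (∑ m, α.conv (G.invol (f m i)) (f m j)) k - T i j k = 0
        rw [(hf i j).1 k hk, ← hT, hK0 i j k hk, sub_zero]
      · change ‖(∑ m, α.conv (G.invol (f m i)) (f m j)) k - T i j k‖ ≤ δ'
        rw [← hT]
        exact (hf i j).2 k
    calc _ ≤ ∑ i : n, ∑ j : n, ε' := (norm_sum_le _ _).trans (Finset.sum_le_sum fun i _ =>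
          (norm_sum_le _ _).trans (Finset.sum_le_sum fun j _ => hb i j))
      _ = Fintype.card n * Fintype.card n * ε' := by simp [mul_assoc]
      _ < ε := by
          rw [hε', ← mul_div_assoc, div_lt_iff₀ (by positivity)]
          nlinarith [sq_nonneg (Fintype.card n : ℝ)]

/-- A weight `ρ ≤ c` may be replaced by `c`, because the difference is positive. -/
lemma matrixSum_rangeMul_le {ℓ : n → n → C_c(G₁, ℂ) →ₗ[ℂ] D}
    (hpos : ∀ f : n → C_c(G₁, ℂ), 0 ≤ matrixSum ℓ fun i j => α.conv (G.invol (f i)) (f j))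
    (ρ : C(G₀, ℝ)) {c : ℝ} (hρ : ∀ x, ρ x ≤ c) (f : n → C_c(G₁, ℂ)) :
    matrixSum ℓ (fun i j => α.conv (G.invol (f i))
      (G.rangeMul ⟨fun x => (ρ x : ℂ), by fun_prop⟩ (f j))) ≤
      c • matrixSum ℓ fun i j => α.conv (G.invol (f i)) (f j) := by
  have h := hpos fun i => G.rangeMul ⟨fun x => (√(c - ρ x) : ℂ), by fun_prop⟩ (f i)
  have e : (fun i j => α.conv (G.invol (G.rangeMul ⟨fun x => (√(c - ρ x) : ℂ), by fun_prop⟩ (f i)))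
      (G.rangeMul ⟨fun x => (√(c - ρ x) : ℂ), by fun_prop⟩ (f j))) =
      (c : ℂ) • (fun i j => α.conv (G.invol (f i)) (f j)) - fun i j => α.conv (G.invol (f i))
      (G.rangeMul ⟨fun x => (ρ x : ℂ), by fun_prop⟩ (f j)) := by
    funext i j
    have := α.invol_conv_rangeMul_sqrt ⟨fun x => c - ρ x, by fun_prop⟩
      (fun x => sub_nonneg.2 (hρ x)) (f i) (f j)
    refine this.trans ?_
    change _ = (c : ℂ) • α.conv (G.invol (f i)) (f j) - α.conv _ _
    rw [eq_sub_iff_add_eq, ← α.conv_add, ← α.conv_smul]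
    congr 1
    ext g
    change ((c - ρ (G.r g) : ℝ) : ℂ) * f j g + (ρ (G.r g) : ℂ) * f j g = c * f j g
    push_cast
    ring
  rw [e, map_sub, map_smul, Complex.coe_smul, sub_nonneg] at h
  exact h

/-- The operator inequality `L(f)^* L(f) ≤ c²` for `c ≥ ‖f‖_I`, tested on a vector `∑ L(k_i) ξ_i`.
It follows from the arithmetic-geometric mean form of the Cauchy–Schwarz inequality `0 ≤ ⟨Φ, Φ⟩`
for `Φ = a ⊗ L(f) v - c U (b ⊗ v)`. -/
lemma matrixSum_conv_le {ℓ : n → n → C_c(G₁, ℂ) →ₗ[ℂ] D}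
    (hℓ : ∀ i j, IsCompactlyContinuous (ℓ i j))
    (hpos : ∀ f : n → C_c(G₁, ℂ), 0 ≤ matrixSum ℓ fun i j => α.conv (G.invol (f i)) (f j))
    (f : C_c(G₁, ℂ)) (k : n → C_c(G₁, ℂ)) {c : ℝ} (hc : 0 < c) (hfc : α.iNorm f ≤ c) :
    matrixSum ℓ (fun i j => α.conv (G.invol (α.conv f (k i))) (α.conv f (k j))) ≤
      c ^ 2 • matrixSum ℓ fun i j => α.conv (G.invol (k i)) (k j) := by
  obtain ⟨Φ, hΦ⟩ := α.exists_pairing_eq f k c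
  have h := matrixSum_pairing_nonneg α hℓ hpos Φ _ hΦ
  have h1 := matrixSum_rangeMul_le α hpos (α.rangeIntegral f) (c := c)
    (fun x => (α.rangeIntegral_le_iNorm f x).trans hfc) fun i => α.conv f (k i)
  have h2 := matrixSum_rangeMul_le α hpos (α.sourceIntegral f) (c := c)
    (fun x => (α.sourceIntegral_le_iNorm f x).trans hfc) k
  set A := matrixSum ℓ (fun i j => α.conv (G.invol (α.conv f (k i)))
    (G.rangeMul ⟨fun x => (α.rangeIntegral f x : ℂ), by fun_prop⟩ (α.conv f (k j))))
  set B := matrixSum ℓ (fun i j => α.conv (G.invol (k i))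
    (G.rangeMul ⟨fun x => (α.sourceIntegral f x : ℂ), by fun_prop⟩ (k j)))
  set W := matrixSum ℓ (fun i j => α.conv (G.invol (α.conv f (k i))) (α.conv f (k j)))
  set V := matrixSum ℓ (fun i j => α.conv (G.invol (k i)) (k j))
  have h' : 0 ≤ A - (2 * c) • W + c ^ 2 • B := by
    rw [← Complex.coe_smul, ← Complex.coe_smul, ← map_smul, ← map_smul, ← map_sub, ← map_add]
    exact h
  -- `A ≤ c W` and `B ≤ c V`, so that `0 ≤ (c - 2 c) W + c³ V`
  have h3 : c • W ≤ c • (c ^ 2 • V) := by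
    have h4 : A - (2 * c) • W + c ^ 2 • B ≤ c • W - (2 * c) • W + c ^ 2 • (c • V) :=
      add_le_add (sub_le_sub_right h1 _) (smul_le_smul_of_nonneg_left h2 (by positivity))
    have h5 := h'.trans h4
    rw [← sub_smul, smul_comm (c ^ 2) c V, show c - 2 * c = -c by ring, neg_smul, neg_add_eq_sub,
      sub_nonneg] at h5
    exact h5
  exact le_of_smul_le_smul_left h3 hc

end Positivity

/-! ### The inner product of a right Hilbert module -/

section RightInner

variable {D F : Type*} [NonUnitalCStarAlgebra D] [PartialOrder D]
  [NormedAddCommGroup F] [NormedSpace ℂ F] [SMul Dᵐᵒᵖ F] [CStarModule Dᵐᵒᵖ F]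

lemma star_rightInner (ξ η : F) : star (rightInner D ξ η) = rightInner D η ξ := by
  rw [rightInner, ← unop_star, CStarModule.star_inner, rightInner]

lemma rightInner_self_nonneg (ξ : F) : 0 ≤ rightInner D ξ ξ :=
  CStarModule.inner_self_nonneg (A := Dᵐᵒᵖ) (x := ξ)

variable (D) in
lemma norm_sq_eq_norm_rightInner (ξ : F) : ‖ξ‖ ^ 2 = ‖rightInner D ξ ξ‖ :=
  CStarModule.norm_sq_eq Dᵐᵒᵖ

lemma rightInner_self_eq_zero {ξ : F} (h : rightInner D ξ ξ = 0) : ξ = 0 :=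
  (CStarModule.inner_self (A := Dᵐᵒᵖ)).1 (unop_injective h)

variable [StarOrderedRing D]

variable (D) in
/-- The inner product with a fixed vector on the left, as a continuous linear map. -/
noncomputable def rightInnerCLM (ξ : F) : F →L[ℂ] D :=
  LinearMap.mkContinuous
    { toFun := fun η => rightInner D ξ η
      map_add' := fun η η' => by simp [rightInner]
      map_smul' := fun c η => by simp [rightInner] } ‖ξ‖
    fun _ => CStarModule.norm_inner_le (A := Dᵐᵒᵖ) F

lemma rightInnerCLM_apply (ξ η : F) : rightInnerCLM D ξ η = rightInner D ξ η := rfl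

lemma rightInner_sum_sum {n : Type*} [Fintype n] (x : n → F) :
    rightInner D (∑ i, x i) (∑ i, x i) = ∑ i, ∑ j, rightInner D (x i) (x j) := by
  have h : ∀ y, rightInner D (∑ i, x i) y = ∑ i, rightInner D (x i) y := fun y => by
    rw [← star_rightInner, ← rightInnerCLM_apply, map_sum, star_sum]
    exact Finset.sum_congr rfl fun i _ => star_rightInner _ _
  rw [h]
  refine Finset.sum_congr rfl fun i _ => ?_
  rw [← rightInnerCLM_apply, map_sum]
  rfl

end RightInner

/-! ### The representation generated by a pre-representation -/

/-- Extension by continuity along a map with dense range.  The domain is only assumed to be an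
additive monoid, like the finitely supported functions with values in `C_c(G¹)`. -/
lemma LinearMap.exists_extension_of_norm_le {E F : Type*} [AddCommMonoid E] [Module ℂ E]
    [NormedAddCommGroup F] [NormedSpace ℂ F] [CompleteSpace F] {f e : E →ₗ[ℂ] F}
    (he : DenseRange e) {C : ℝ} (hC : 0 ≤ C) (h : ∀ t, ‖f t‖ ≤ C * ‖e t‖) :
    ∃ T : F →L[ℂ] F, ‖T‖ ≤ C ∧ ∀ t, T (e t) = f t := by
  let _ : AddCommGroup E := Module.addCommMonoidToAddCommGroup ℂ
  exact ⟨f.extendOfNorm e, opNorm_extendOfNorm_le he hC h, extendOfNorm_eq he ⟨C, h⟩⟩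

namespace PreRepresentation

variable {G₀ G₁ : Type*} [TopologicalSpace G₀] [T2Space G₀] [TopologicalSpace G₁] [T2Space G₁]
  [LocallyCompactSpace G₁] [MeasurableSpace G₁] [BorelSpace G₁] {G : TopologicalGroupoid G₀ G₁}
  {α : HaarSystem G} {D F F₀ : Type*} [NonUnitalCStarAlgebra D] [PartialOrder D]
  [NormedAddCommGroup F] [NormedSpace ℂ F] [SMul Dᵐᵒᵖ F] [CStarModule Dᵐᵒᵖ F]
  [AddCommGroup F₀] [Module ℂ F₀] (P : PreRepresentation α D F F₀)

/-- The linear map `∑ k_i ⊗ ξ_i ↦ ∑ L(f * k_i) ξ_i`, where finitely supported functions on `F₀` with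
values in `C_c(G¹)` stand for tensors. -/
noncomputable def convSum (f : C_c(G₁, ℂ)) : (F₀ →₀ C_c(G₁, ℂ)) →ₗ[ℂ] F :=
  Finsupp.lsum ℂ fun ξ => P.L.flip ξ ∘ₗ
    { toFun := α.conv f, map_add' := α.conv_add f, map_smul' := fun c k => α.conv_smul c f k }

/-- The linear map `∑ k_i ⊗ ξ_i ↦ ∑ L(k_i) ξ_i`. -/
noncomputable def totalSum : (F₀ →₀ C_c(G₁, ℂ)) →ₗ[ℂ] F := Finsupp.lsum ℂ fun ξ => P.L.flip ξ

lemma convSum_single (f k : C_c(G₁, ℂ)) (ξ : F₀) :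
    P.convSum f (Finsupp.single ξ k) = P.L (α.conv f k) ξ :=
  Finsupp.lsum_single ..

lemma totalSum_single (k : C_c(G₁, ℂ)) (ξ : F₀) :
    P.totalSum (Finsupp.single ξ k) = P.L k ξ :=
  Finsupp.lsum_single ..

lemma denseRange_totalSum : DenseRange P.totalSum := by
  refine P.nondegenerate.mono ?_
  have h : Submodule.span ℂ {v : F | ∃ f ξ, P.L f ξ = v} ≤ LinearMap.range P.totalSum := by
    refine Submodule.span_le.2 ?_
    rintro _ ⟨f, ξ, rfl⟩
    exact ⟨_, P.totalSum_single f ξ⟩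
  exact h

lemma continuousLinearMap_ext {E : Type*} [NormedAddCommGroup E] [NormedSpace ℂ E]
    {A B : F →L[ℂ] E} (h : ∀ k ξ, A (P.L k ξ) = B (P.L k ξ)) : A = B :=
  ContinuousLinearMap.ext_on P.nondegenerate (by rintro _ ⟨k, ξ, rfl⟩; exact h k ξ)

variable [StarOrderedRing D]

/-- The estimate that makes `L(k) ξ ↦ L(f * k) ξ` well defined and bounded. -/
lemma norm_sum_conv_le {n : Type*} [Fintype n] (f : C_c(G₁, ℂ)) (k : n → C_c(G₁, ℂ)) (ξ : n → F₀) :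
    ‖∑ i, P.L (α.conv f (k i)) (ξ i)‖ ≤ α.iNorm f * ‖∑ i, P.L (k i) (ξ i)‖ := by
  let ℓ : n → n → C_c(G₁, ℂ) →ₗ[ℂ] D := fun i j =>
    (rightInnerCLM D (P.ι (ξ i))).toLinearMap ∘ₗ P.L.flip (ξ j)
  have hℓ : ∀ i j, IsCompactlyContinuous (ℓ i j) := fun i j =>
    isCompactlyContinuous_of_continuous (P.continuous_inner (ξ i) (ξ j))
  have hsum : ∀ k : n → C_c(G₁, ℂ), matrixSum ℓ (fun i j => α.conv (G.invol (k i)) (k j)) =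
      rightInner D (∑ i, P.L (k i) (ξ i)) (∑ i, P.L (k i) (ξ i)) := fun k => by
    rw [matrixSum_apply, rightInner_sum_sum]
    exact Finset.sum_congr rfl fun i _ => Finset.sum_congr rfl fun j _ =>
      (P.inner_eq (k i) (k j) (ξ i) (ξ j)).symm
  have hpos : ∀ k : n → C_c(G₁, ℂ),
      0 ≤ matrixSum ℓ fun i j => α.conv (G.invol (k i)) (k j) := fun k => by
    rw [hsum]; exact rightInner_self_nonneg _
  have key : ∀ c, α.iNorm f < c →
      ‖∑ i, P.L (α.conv f (k i)) (ξ i)‖ ≤ c * ‖∑ i, P.L (k i) (ξ i)‖ := by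
    intro c hc
    have hc0 : 0 < c := (α.iNorm_nonneg f).trans_lt hc
    have h := matrixSum_conv_le α hℓ hpos f k hc0 hc.le
    rw [hsum k, hsum fun i => α.conv f (k i)] at h
    have h2 := CStarAlgebra.norm_le_norm_of_nonneg_of_le (rightInner_self_nonneg _) h
    rw [norm_smul, ← norm_sq_eq_norm_rightInner, ← norm_sq_eq_norm_rightInner,
      Real.norm_of_nonneg (by positivity), ← mul_pow] at h2
    exact le_of_sq_le_sq h2 (by positivity)
  have ht : Tendsto (fun c => c * ‖∑ i, P.L (k i) (ξ i)‖) (𝓝[>] (α.iNorm f))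
      (𝓝 (α.iNorm f * ‖∑ i, P.L (k i) (ξ i)‖)) :=
    ((continuous_id.mul continuous_const).tendsto _).mono_left nhdsWithin_le_nhds
  exact ge_of_tendsto ht (eventually_nhdsWithin_of_forall key)

lemma norm_convSum_le (f : C_c(G₁, ℂ)) (t : F₀ →₀ C_c(G₁, ℂ)) :
    ‖P.convSum f t‖ ≤ α.iNorm f * ‖P.totalSum t‖ := by
  rw [convSum, totalSum, Finsupp.lsum_apply, Finsupp.lsum_apply, Finsupp.sum, Finsupp.sum,
    ← Finset.sum_coe_sort, ← Finset.sum_coe_sort t.support]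
  exact P.norm_sum_conv_le f (fun ξ : t.support => t ξ) fun ξ => ξ

variable [CompleteSpace F]

lemma exists_operator (f : C_c(G₁, ℂ)) :
    ∃ T : F →L[ℂ] F, ‖T‖ ≤ α.iNorm f ∧ ∀ t, T (P.totalSum t) = P.convSum f t :=
  LinearMap.exists_extension_of_norm_le P.denseRange_totalSum (α.iNorm_nonneg f)
    (P.norm_convSum_le f)

/-- The bounded operator on `F` with `L(k) ξ ↦ L(f * k) ξ`. -/
noncomputable def operator (f : C_c(G₁, ℂ)) : F →L[ℂ] F := (P.exists_operator f).choose

lemma operator_apply (f k : C_c(G₁, ℂ)) (ξ : F₀) :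
    P.operator f (P.L k ξ) = P.L (α.conv f k) ξ := by
  rw [← totalSum_single, ← convSum_single]
  exact (P.exists_operator f).choose_spec.2 _

lemma norm_operator_le (f : C_c(G₁, ℂ)) : ‖P.operator f‖ ≤ α.iNorm f :=
  (P.exists_operator f).choose_spec.1

/-- The adjoint relation, first for `v = L(k) ξ` and `w = L(k') η`, then for `v = L(k) ξ` and all `w`,
and then for all `v` and `w`. -/
lemma rightInner_operator (f : C_c(G₁, ℂ)) (v w : F) :
    rightInner D (P.operator f v) w = rightInner D v (P.operator (G.invol f) w) := by
  have h1 : ∀ k ξ w, rightInner D (P.operator f (P.L k ξ)) w =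
      rightInner D (P.L k ξ) (P.operator (G.invol f) w) := by
    intro k ξ w
    have : rightInnerCLM D (P.operator f (P.L k ξ)) =
        (rightInnerCLM D (P.L k ξ)).comp (P.operator (G.invol f)) := by
      refine P.continuousLinearMap_ext fun k' η => ?_
      change rightInner D _ _ = rightInner D _ (P.operator (G.invol f) _)
      rw [operator_apply, operator_apply, P.inner_eq, P.inner_eq, α.invol_conv, α.conv_assoc]
    exact DFunLike.congr_fun this w
  have h2 : (rightInnerCLM D w).comp (P.operator f) =
      rightInnerCLM D (P.operator (G.invol f) w) := by
    refine P.continuousLinearMap_ext fun k ξ => ?_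
    change rightInner D _ (P.operator f _) = rightInner D _ _
    rw [← star_rightInner, h1, star_rightInner]
  rw [← star_rightInner]
  change star ((rightInnerCLM D w).comp (P.operator f) v) = _
  rw [h2, rightInnerCLM_apply, star_rightInner]

/-- The operators extend the given action.  Axiom `inner_eq` only computes inner products of two
vectors `L(k) η` and `L(f) ξ`, but these vectors span a dense subspace. -/
lemma operator_ι (f : C_c(G₁, ℂ)) (ξ : F₀) : P.operator f (P.ι ξ) = P.L f ξ := by
  rw [← sub_eq_zero]
  set x := P.operator f (P.ι ξ) - P.L f ξ with hx
  have h : rightInnerCLM D x = 0 := by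
    refine P.continuousLinearMap_ext fun k η => ?_
    change rightInner D _ _ = 0
    rw [← star_rightInner, star_eq_zero, ← rightInnerCLM_apply, hx, map_sub, sub_eq_zero]
    change rightInner D _ _ = rightInner D _ _
    rw [← G.invol_invol f, ← rightInner_operator, operator_apply, G.invol_invol,
      ← star_rightInner, ← P.inner_eq, star_rightInner]
  exact rightInner_self_eq_zero (D := D) (DFunLike.congr_fun h x)

/-- The representation by bounded operators that a pre-representation generates. -/
noncomputable def toCcRepresentation : CcRepresentation α D F where
  L :=
    { toFun := P.operator
      map_add' := fun f₁ f₂ => P.continuousLinearMap_ext fun k ξ => by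
        simp [operator_apply, α.add_conv]
      map_smul' := fun c f => P.continuousLinearMap_ext fun k ξ => by
        simp [operator_apply, α.smul_conv] }
  map_conv f₁ f₂ := P.continuousLinearMap_ext fun k ξ => by
    simp [operator_apply, α.conv_assoc]
  inner_star := P.rightInner_operator
  nondegenerate := P.nondegenerate.mono (Submodule.span_mono (by
    rintro _ ⟨f, ξ, rfl⟩
    exact ⟨f, P.ι ξ, P.operator_ι f ξ⟩))

end PreRepresentation

/-! ### Continuity of representations -/

namespace CcRepresentation

variable {G₀ G₁ : Type*} [TopologicalSpace G₀] [T2Space G₀] [TopologicalSpace G₁] [T2Space G₁]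
  [LocallyCompactSpace G₁] [MeasurableSpace G₁] [BorelSpace G₁] {G : TopologicalGroupoid G₀ G₁}
  {α : HaarSystem G} {D F : Type*} [NonUnitalCStarAlgebra D] [PartialOrder D]
  [NormedAddCommGroup F] [NormedSpace ℂ F] [SMul Dᵐᵒᵖ F] [CStarModule Dᵐᵒᵖ F]
  (R : CcRepresentation α D F)

/-- A representation that is weakly continuous in the inductive limit topology, viewed as a
pre-representation with domain `F`. -/
noncomputable def toPreRepresentation
    (h : ∀ ξ η : F, Continuous[inductiveLimitTopology G₁, inferInstance]
      fun f => rightInner D ξ (R.L f η)) : PreRepresentation α D F F where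
  ι := LinearMap.id
  denseRange_ι := denseRange_id
  L := ContinuousLinearMap.coeLM ℂ ∘ₗ R.L
  continuous_inner := h
  inner_eq f₁ f₂ ξ η := by
    change rightInner D (R.L f₁ ξ) (R.L f₂ η) = rightInner D ξ (R.L _ η)
    rw [R.inner_star, R.map_conv]
    rfl
  nondegenerate := R.nondegenerate

variable {R}

lemma IsINormBounded.continuous (h : R.IsINormBounded) :
    Continuous[inductiveLimitTopology G₁, inferInstance] fun f => R.L f := by
  obtain ⟨C, hC⟩ := h
  refine continuous_inductiveLimitTopology R.L fun K hK => ?_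
  obtain ⟨N, -, hN⟩ := α.exists_iNorm_le hK
  refine ⟨|C| * N, fun f hf M hM hfM => (hC f).trans ?_⟩
  rw [mul_assoc]
  exact mul_le_mul (le_abs_self C) (hN f hf M hM hfM) (α.iNorm_nonneg f) (abs_nonneg C)

variable [StarOrderedRing D]

lemma continuous_rightInner
    (h : Continuous[inductiveLimitTopology G₁, inferInstance] fun f => R.L f) (ξ η : F) :
    Continuous[inductiveLimitTopology G₁, inferInstance] fun f => rightInner D ξ (R.L f η) := by
  have h1 : Continuous fun T : F →L[ℂ] F => rightInnerCLM D ξ (T η) := by fun_prop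
  exact @Continuous.comp _ _ _ (inductiveLimitTopology G₁) _ _
    (fun f => R.L f) (fun T => rightInnerCLM D ξ (T η)) h1 h

lemma isINormBounded_of_continuous_rightInner [CompleteSpace F]
    (h : ∀ ξ η : F, Continuous[inductiveLimitTopology G₁, inferInstance]
      fun f => rightInner D ξ (R.L f η)) : R.IsINormBounded := by
  refine ⟨1, fun f => ?_⟩
  have e : R.L f = (R.toPreRepresentation h).operator f :=
    ContinuousLinearMap.ext fun ξ => ((R.toPreRepresentation h).operator_ι f ξ).symm
  rw [e, one_mul]
  exact (R.toPreRepresentation h).norm_operator_le f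

end CcRepresentation

theorem mainTheorem2 {G₀ G₁ : Type*} [TopologicalSpace G₀] [T2Space G₀] [LocallyCompactSpace G₀]
    [TopologicalSpace G₁] [T2Space G₁] [LocallyCompactSpace G₁] [MeasurableSpace G₁] [BorelSpace G₁]
    (G : TopologicalGroupoid G₀ G₁) (α : HaarSystem G)
    {D F : Type*} [NonUnitalCStarAlgebra D] [PartialOrder D] [StarOrderedRing D]
    [NormedAddCommGroup F] [NormedSpace ℂ F] [CompleteSpace F] [SMul Dᵐᵒᵖ F] [CStarModule Dᵐᵒᵖ F] :
    (∀ (F₀ : Type*) [AddCommGroup F₀] [Module ℂ F₀] (P : PreRepresentation α D F F₀),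
      ∃ R : CcRepresentation α D F, R.IsINormBounded ∧
        ∀ (f : C_c(G₁, ℂ)) (ξ : F₀), R.L f (P.ι ξ) = P.L f ξ) ∧
    (∀ R : CcRepresentation α D F,
      (R.IsINormBounded ↔ Continuous[inductiveLimitTopology G₁, inferInstance] fun f => R.L f) ∧
      (R.IsINormBounded ↔ ∀ ξ η : F,
        Continuous[inductiveLimitTopology G₁, inferInstance]
          fun f => rightInner D ξ (R.L f η))) := by
  refine ⟨fun F₀ _ _ P => ⟨P.toCcRepresentation, ⟨1, fun f => ?_⟩, P.operator_ι⟩,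
    fun R => ⟨⟨fun h => h.continuous, fun h => ?_⟩, ⟨fun h => ?_, fun h => ?_⟩⟩⟩
  · rw [one_mul]
    exact P.norm_operator_le f
  · exact CcRepresentation.isINormBounded_of_continuous_rightInner
      (CcRepresentation.continuous_rightInner h)
  · exact CcRepresentation.continuous_rightInner h.continuous
  · exact CcRepresentation.isINormBounded_of_continuous_rightInner h
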